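/- Let $n\ge 3$, let $\eta=\mathrm{diag}(1,1,-1,\dots,-1)$ and let $\mathfrak g=\mathfrak{so}(2,n)^{\mathbb C}$ be the Lie algebra of complex $(n+2)\times(n+2)$ matrices $A$ with $A^{T}\eta+\eta A=0$. Let $\mathfrak k\simeq(\mathfrak{so}(2)\oplus\mathfrak{so}(n))^{\mathbb C}$ be its subalgebra of block diagonal matrices, and let $r=\lfloor (n+2)/2\rfloor$. Let $j,k$ range over $\{-r,\dots,r\}$, with $0$ omitted when $n$ is even. With $f_{-1},f_0,f_1,\dots,f_n$ the standard basis of $\mathbb C^{n+2}$, put $e_j=f_{2j-3}+i f_{2j-2}$ for $j\ge1$, $e_{-1}=\frac12(f_{-1}-i f_0)$, $e_{-j}=-\frac12(f_{2j-3}-i f_{2j-2})$ for $j\ge2$ and, for odd $n$, $e_0=i f_n$; this is a basis of $\mathbb C^{n+2}$ with $e_j^{T}\eta\, e_k=\delta_{j,-k}$. Let $X_{jk}\in\mathfrak g$ be the map $v\mapsto (e_j^T\eta v)\,e_k-(e_k^T\eta v)\,e_j$. Then $X_{jk}=-X_{kj}$ and $$[X_{jk},X_{j'k'}]=\delta_{j,-j'}X_{kk'}+\delta_{k,-k'}X_{jj'}-\delta_{j,-k'}X_{kj'}-\delta_{k,-j'}X_{jk'}.$$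 Put $H_i=X_{-i,i}$ for $1\le i\le r$ and $\mathfrak p^{+}=\langle X_{1,j} : |j|\neq1\rangle$. Let $E_0>0$ be real and $\lambda=(-E_0,0,\dots,0)$. Let $K(\lambda)$ be the one-dimensional $\mathfrak k$-module on which $H_1$ acts by $-E_0$ and $\mathfrak{so}(n)^{\mathbb C}$ acts by $0$, extended to $\mathfrak k+\mathfrak p^+$ by letting $\mathfrak p^+$ act by $0$. Let $$N(\lambda)=\mathcal U(\mathfrak g)\otimes_{\mathcal U(\mathfrak k+\mathfrak p^+)}K(\lambda)$$ with highest weight vector $v_\lambda$, and let $L(\lambda)$ be its irreducible quotient, i.e. the quotient by the sum of all proper submodules. Put $\mathbf Z=\sum_{|h|\neq1}X_{-1,h}X_{-1,-h}\in\mathcal U(\mathfrak g)$ and $v_{lk}=(X_{-1,2})^{l}\,\mathbf Z^{k}v_\lambda\in N(\lambda)$ for integers $l,k\ge0$. Then: 1. $N(\lambda)=\bigoplus_{l,k\ge0}\mathcal U(\mathfrak k)v_{lk}$. 2. $N(\lambda)$ is irreducible if and only if $E_0\notin\{\frac n2-1,\dots,\frac n2-\lfloor\frac{n-1}2\rfloor\}$.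 3. If $E_0=\frac n2-j$ with $j\in\{1,\dots,\lfloor\frac{n-1}2\rfloor\}$, then $L(\lambda)$ is irreducible, the sum $\bigoplus_{l,k\ge0}\mathcal U(\mathfrak k)v_{l,j+k}$ is direct and is a $\mathfrak g$-submodule of $N(\lambda)$, and $$L(\lambda)\simeq N(\lambda)\Big/\bigoplus_{l,k\ge0}\mathcal U(\mathfrak k)v_{l,j+k}$$ as $\mathfrak g$-modules, compatibly with the projections from $N(\lambda)$. Moreover the projection $N(\lambda)\to L(\lambda)$ induces an isomorphism of $\mathfrak k$-modules $\bigoplus_{l\ge0}\bigoplus_{k=0}^{j-1}\mathcal U(\mathfrak k)v_{lk}\simeq L(\lambda)$. -/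

import Mathlib

open scoped TensorProduct DirectSum

noncomputable section

attribute [local instance 100] LieRing.ofAssociativeRing

/-! Modules induced from a Lie subalgebra. -/
namespace LieInduced

variable {R g V : Type*} [CommRing R] [LieRing g] [LieAlgebra R g]
  [AddCommGroup V] [Module R V]

/-- The `U(g)`-submodule of `U(g) ⊗ V` spanned by the elements `y ⊗ v - 1 ⊗ y v`, `y ∈ q`. -/
def relations (q : LieSubalgebra R g) (ρ : q →ₗ⁅R⁆ Module.End R V) :
    Submodule (UniversalEnvelopingAlgebra R g) (UniversalEnvelopingAlgebra R g ⊗[R] V) :=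
  Submodule.span (UniversalEnvelopingAlgebra R g)
    {t | ∃ (y : q) (v : V),
      t = (UniversalEnvelopingAlgebra.ι R (y : g)) ⊗ₜ[R] v
        - (1 : UniversalEnvelopingAlgebra R g) ⊗ₜ[R] (ρ y v)}

/-- The induced module `U(g) ⊗_{U(q)} V` of a `q`-module `(ρ, V)`, as a left `U(g)`-module. -/
abbrev Ind (q : LieSubalgebra R g) (ρ : q →ₗ⁅R⁆ Module.End R V) : Type _ :=
  (UniversalEnvelopingAlgebra R g ⊗[R] V) ⧸ relations q ρ

/-- The element `u ⊗ v` of the induced module. -/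
def Ind.tmul (q : LieSubalgebra R g) (ρ : q →ₗ⁅R⁆ Module.End R V)
    (u : UniversalEnvelopingAlgebra R g) (v : V) : Ind q ρ :=
  (relations q ρ).mkQ (u ⊗ₜ[R] v)

/-- The sum of all proper submodules; for a highest weight module this is the largest proper
submodule. -/
def maxProper (A M : Type*) [Ring A] [AddCommGroup M] [Module A M] : Submodule A M :=
  sSup {S | S ≠ ⊤}

end LieInduced

namespace SO2n

open Complex Matrix

/-- The complexification of `so(2,n)`: complex matrices `A` with `Aᵀ η + η A = 0`,
`η = diag(1,1,-1,…,-1)`. -/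
abbrev G (n : ℕ) : Type := LieAlgebra.Orthogonal.so' (Fin 2) (Fin n) ℂ

/-- The universal enveloping algebra of the complexification of `so(2,n)`. -/
abbrev U (n : ℕ) : Type := UniversalEnvelopingAlgebra ℂ (G n)

/-- The matrix `η = diag(1,1,-1,…,-1)`. -/
abbrev eta (n : ℕ) : Matrix (Fin 2 ⊕ Fin n) (Fin 2 ⊕ Fin n) ℂ :=
  LieAlgebra.Orthogonal.indefiniteDiagonal (Fin 2) (Fin n) ℂ

lemma mem_so' {n : ℕ} (A : Matrix (Fin 2 ⊕ Fin n) (Fin 2 ⊕ Fin n) ℂ) :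
    A ∈ LieAlgebra.Orthogonal.so' (Fin 2) (Fin n) ℂ ↔ Aᵀ * eta n = -(eta n * A) := by
  simp [LieAlgebra.Orthogonal.so', Matrix.IsSkewAdjoint, Matrix.IsAdjointPair]

/-- The complexification of the maximal compact subalgebra `so(2) ⊕ so(n)`: the block diagonal
elements. -/
def k (n : ℕ) : LieSubalgebra ℂ (G n) where
  carrier := {A | ∀ (a : Fin 2) (i : Fin n),
    A.1 (Sum.inl a) (Sum.inr i) = 0 ∧ A.1 (Sum.inr i) (Sum.inl a) = 0}
  add_mem' := fun {A B} hA hB a i => by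
    simp [(hA a i).1, (hA a i).2, (hB a i).1, (hB a i).2]
  zero_mem' := fun a i => by simp
  smul_mem' := fun c A hA a i => by simp [(hA a i).1, (hA a i).2]
  lie_mem' := fun {A B} hA hB a i => by
    have hA1 : ∀ a i, A.1 (Sum.inl a) (Sum.inr i) = 0 := fun a i => (hA a i).1
    have hA2 : ∀ a i, A.1 (Sum.inr i) (Sum.inl a) = 0 := fun a i => (hA a i).2
    have hB1 : ∀ a i, B.1 (Sum.inl a) (Sum.inr i) = 0 := fun a i => (hB a i).1
    have hB2 : ∀ a i, B.1 (Sum.inr i) (Sum.inl a) = 0 := fun a i => (hB a i).2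
    simp only [LieSubalgebra.coe_bracket, Ring.lie_def, Matrix.sub_apply, Matrix.mul_apply,
      Fintype.sum_sum_type, hA1, hA2, hB1, hB2]
    simp

/-- The image of `U(k)` in `U(g)`, i.e. the associative subalgebra generated by `k`. -/
def Uk (n : ℕ) : Subalgebra ℂ (U n) :=
  Algebra.adjoin ℂ (UniversalEnvelopingAlgebra.ι ℂ '' (k n : Set (G n)))

/-- The standard basis vectors `f_{-1}, f_0, f_1, …, f_n` of `ℂ^{2+n}`. -/
def f (n : ℕ) (a : ℤ) : Fin 2 ⊕ Fin n → ℂ :=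
  Sum.elim (fun i => if a = (i : ℤ) - 1 then 1 else 0) (fun i => if a = (i : ℤ) + 1 then 1 else 0)

/-- The matrix `v ↦ ⟨u, v⟩ w - ⟨w, v⟩ u`, where `⟨u, v⟩ = uᵀ η v`. -/
def wedgeMatrix {n : ℕ} (u w : Fin 2 ⊕ Fin n → ℂ) :
    Matrix (Fin 2 ⊕ Fin n) (Fin 2 ⊕ Fin n) ℂ :=
  vecMulVec w (u ᵥ* eta n) - vecMulVec u (w ᵥ* eta n)

lemma wedgeMatrix_mem {n : ℕ} (u w : Fin 2 ⊕ Fin n → ℂ) :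
    wedgeMatrix u w ∈ LieAlgebra.Orthogonal.so' (Fin 2) (Fin n) ℂ := by
  rw [mem_so']
  ext i j
  simp only [wedgeMatrix, eta, LieAlgebra.Orthogonal.indefiniteDiagonal, Matrix.mul_diagonal,
    Matrix.diagonal_mul, Matrix.transpose_apply, Matrix.sub_apply, vecMulVec_apply,
    vecMul_diagonal, Matrix.neg_apply]
  ring

/-- The element `v ↦ ⟨u, v⟩ w - ⟨w, v⟩ u` of the complexified `so(2,n)`. -/
def wedge {n : ℕ} (u w : Fin 2 ⊕ Fin n → ℂ) : G n := ⟨wedgeMatrix u w, wedgeMatrix_mem u w⟩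

/-- The rank `r` of the complexified `so(2,n)`. -/
def rk (n : ℕ) : ℕ := (n + 2) / 2

/-- The index set `{-r, …, r}`, where `0` occurs only for odd `n`. -/
def idx (n : ℕ) : Finset ℤ :=
  (Finset.Icc (-(rk n : ℤ)) (rk n)).filter (fun j => j ≠ 0 ∨ Odd n)

/-- A basis `(e_j)`, `j ∈ idx n`, of `ℂ^{2+n}` with `⟨e_j, e_k⟩ = δ_{j,-k}`; the vectors `e_{±1}`
span the two-dimensional positive part and the others the `n`-dimensional negative part. -/
def e (n : ℕ) (j : ℤ) : Fin 2 ⊕ Fin n → ℂ :=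
  if j = 0 then I • f n n
  else if 0 < j then f n (2 * j - 3) + I • f n (2 * j - 2)
  else (if j = -1 then (1 / 2 : ℂ) else -(1 / 2)) • (f n (-2 * j - 3) - I • f n (-2 * j - 2))

/-- The elements `X_{jk}`, `j, k ∈ idx n`: they satisfy `X_{jk} = -X_{kj}` and
`[X_{jk}, X_{j'k'}] = δ_{j,-j'} X_{kk'} + δ_{k,-k'} X_{jj'} - δ_{j,-k'} X_{kj'} - δ_{k,-j'} X_{jk'}`,
and the `X_{jk}` with `j < k` form a basis. -/
def X (n : ℕ) (j k : ℤ) : G n := wedge (e n j) (e n k)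

/-- `p⁺`, spanned by the `X_{1,j}` with `|j| ≠ 1`. -/
def pPlus (n : ℕ) : Submodule ℂ (G n) :=
  Submodule.span ℂ {A | ∃ j ∈ idx n, |j| ≠ 1 ∧ A = X n 1 j}

/-- The parabolic subalgebra `q = k + p⁺` (the Lie subalgebra generated by `k` and `p⁺`). -/
def q (n : ℕ) : LieSubalgebra ℂ (G n) :=
  LieSubalgebra.lieSpan ℂ (G n) ((k n : Set (G n)) ∪ (pPlus n : Set (G n)))

/-- `q` preserves the line spanned by `e_1`; `weight₁ A` is the eigenvalue of `A` there.
Thus `weight₁` vanishes on `p⁺` and on `so(n)`, and takes the value `1` at `H_1 = X_{-1,1}`. -/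
def weight₁ (n : ℕ) : G n →ₗ[ℂ] ℂ where
  toFun A := (A.1 *ᵥ e n 1) (Sum.inl 0)
  map_add' A B := by simp [Matrix.add_mulVec]
  map_smul' c A := by simp [Matrix.smul_mulVec]

lemma e_one (n : ℕ) : e n 1 = Sum.elim ![1, I] 0 := by
  ext (i | i)
  · fin_cases i <;> simp [e, f]
  · have h1 : ¬ (-1 : ℤ) = (i : ℤ) + 1 := by omega
    have h2 : ¬ (0 : ℤ) = (i : ℤ) + 1 := by omega
    simp [e, f, h1, h2]

lemma q_mulVec (n : ℕ) (A : G n) (hA : A ∈ q n) : A.1 *ᵥ e n 1 = weight₁ n A • e n 1 := by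
  let S : LieSubalgebra ℂ (G n) :=
    { carrier := {A | ∃ c : ℂ, A.1 *ᵥ e n 1 = c • e n 1}
      add_mem' := by
        rintro A B ⟨c, hc⟩ ⟨d, hd⟩
        exact ⟨c + d, by simp [Matrix.add_mulVec, hc, hd, add_smul]⟩
      zero_mem' := ⟨0, by simp⟩
      smul_mem' := by
        rintro t A ⟨c, hc⟩
        exact ⟨t * c, by simp [Matrix.smul_mulVec, hc, mul_smul]⟩
      lie_mem' := by
        rintro A B ⟨c, hc⟩ ⟨d, hd⟩
        refine ⟨0, ?_⟩
        simp only [LieSubalgebra.coe_bracket, Ring.lie_def, Matrix.sub_mulVec,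
          ← Matrix.mulVec_mulVec, hc, hd, Matrix.mulVec_smul, smul_smul, mul_comm c d]
        simp }
  have hS : q n ≤ S := by
    refine LieSubalgebra.lieSpan_le.2 (Set.union_subset ?_ ?_)
    · intro A hA
      have hs := (mem_so' A.1).1 A.2
      have h := fun a b => congrFun (congrFun hs (Sum.inl a)) (Sum.inl b)
      simp only [eta, LieAlgebra.Orthogonal.indefiniteDiagonal, Matrix.mul_diagonal,
        Matrix.diagonal_mul, Matrix.transpose_apply, Matrix.neg_apply, Sum.elim_inl, one_mul,
        mul_one] at h
      have h00 : A.1 (Sum.inl 0) (Sum.inl 0) = 0 := by linear_combination (h 0 0) / 2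
      have h11 : A.1 (Sum.inl 1) (Sum.inl 1) = 0 := by linear_combination (h 1 1) / 2
      have h01 := h 0 1
      refine ⟨A.1 (Sum.inl 0) (Sum.inl 1) * I, ?_⟩
      rw [e_one]
      ext (i | i)
      · fin_cases i
        · simp [Matrix.mulVec, dotProduct, h00]
        · simp [Matrix.mulVec, dotProduct, h11, h01, mul_assoc]
      · simp [Matrix.mulVec, dotProduct, (hA _ i).2]
    · change (pPlus n : Set (G n)) ⊆ (S.toSubmodule : Set (G n))
      refine Submodule.span_le.2 ?_
      rintro A ⟨j, -, -, rfl⟩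
      have key : ∀ u w : Fin 2 ⊕ Fin n → ℂ,
          (wedge u w).1 *ᵥ u = (u ᵥ* eta n ⬝ᵥ u) • w - (w ᵥ* eta n ⬝ᵥ u) • u := by
        intro u w
        ext i
        simp [wedge, wedgeMatrix, Matrix.sub_mulVec, vecMulVec_mulVec, mul_comm]
      have h0 : e n 1 ᵥ* eta n ⬝ᵥ e n 1 = 0 := by
        rw [e_one]
        simp [eta, LieAlgebra.Orthogonal.indefiniteDiagonal, dotProduct, vecMul_diagonal]
      refine ⟨-(e n j ᵥ* eta n ⬝ᵥ e n 1), ?_⟩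
      simp [X, key, h0]
  obtain ⟨c, hc⟩ := hS hA
  have : weight₁ n A = c := by
    change (A.1 *ᵥ e n 1) (Sum.inl 0) = c
    rw [hc, e_one]
    simp
  rw [this, hc]

/-- The one-dimensional module `K(λ)`, `λ = (-E₀,0,…,0)`, of `k`, with `p⁺` acting by zero:
`H_1` acts by `-E₀`, and `so(n)` and `p⁺` act by `0`. -/
def K (n : ℕ) (E₀ : ℝ) : q n →ₗ⁅ℂ⁆ Module.End ℂ ℂ where
  toFun A := (-(E₀ : ℂ) * weight₁ n A) • LinearMap.id
  map_add' A B := by simp [mul_add, add_smul]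
  map_smul' c A := by
    ext
    simp
    ring
  map_lie' := by
    intro A B
    have h : weight₁ n ⁅(A : G n), (B : G n)⁆ = 0 := by
      have hA := q_mulVec n A A.2
      have hB := q_mulVec n B B.2
      change ((⁅(A : G n), (B : G n)⁆ : G n).1 *ᵥ e n 1) (Sum.inl 0) = 0
      rw [LieSubalgebra.coe_bracket, Ring.lie_def, Matrix.sub_mulVec, ← Matrix.mulVec_mulVec,
        ← Matrix.mulVec_mulVec, hA, hB, Matrix.mulVec_smul, Matrix.mulVec_smul, hA, hB,
        smul_smul, smul_smul, mul_comm]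
      simp
    ext
    simp [h, Ring.lie_def]
    ring

/-- The induced highest weight module `N(λ) = U(g) ⊗_{U(q)} K(λ)`, `λ = (-E₀,0,…,0)`. -/
abbrev N (n : ℕ) (E₀ : ℝ) : Type := LieInduced.Ind (q n) (K n E₀)

/-- The irreducible quotient `L(λ)` of `N(λ)`: the quotient by the largest proper submodule. -/
abbrev L (n : ℕ) (E₀ : ℝ) : Type := N n E₀ ⧸ LieInduced.maxProper (U n) (N n E₀)

/-- The highest weight vector `v_λ = 1 ⊗ 1` of `N(λ)`. -/
def vTop (n : ℕ) (E₀ : ℝ) : N n E₀ := LieInduced.Ind.tmul (q n) (K n E₀) 1 1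

/-- `Z = ∑_{|h| ≠ 1} X_{-1,h} X_{-1,-h}` in `U(g)`. -/
def Z (n : ℕ) : U n :=
  ∑ h ∈ (idx n).filter (fun h => |h| ≠ 1),
    UniversalEnvelopingAlgebra.ι ℂ (X n (-1) h) * UniversalEnvelopingAlgebra.ι ℂ (X n (-1) (-h))

/-- `v_{lk} = (X_{-1,2})^l Z^k v_λ` in `N(λ)`. -/
def v (n : ℕ) (E₀ : ℝ) (l k : ℕ) : N n E₀ :=
  ((UniversalEnvelopingAlgebra.ι ℂ (X n (-1) 2)) ^ l * Z n ^ k) • vTop n E₀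

/-- The `U(k)`-submodule `U(k) v_{lk}` of `N(λ)`. -/
def Ukv (n : ℕ) (E₀ : ℝ) (l k : ℕ) : Submodule (Uk n) (N n E₀) :=
  Submodule.span (Uk n) {v n E₀ l k}

end SO2n

end

/-! The module `N(λ)` is realised on polynomials. As `p⁻` is abelian and complementary to `k + p⁺`,
the space should be `ℂ[x₁,…,xₙ]`: `p⁻` multiplies by linear forms, `k` acts through the Euler
operator `E` and rotations, and `p⁺` acts through the second order operators `conf E₀ a = ½ (a·x) Δ
- (E + E₀) ∂ₐ`. `rep` shows that this is a representation, and `equivModel` identifies it with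
`N(λ)` by two explicit inverse maps, so the PBW theorem is not needed. Under this identification `Z`
becomes multiplication by `-r²`, and `v_{lk}` becomes `zˡ (-r²)ᵏ` with the isotropic form `z = x₁ +
i x₂`.

The decomposition into the `U(k) v_{lk}` is the classical one of polynomials into `r²ᵏ` times
harmonics of degree `l`. The sum is direct because `E` and `r²Δ` commute with `k` and their joint
eigenvalues determine `(l, k)` (`iSupIndep_modelUkv`). It is everything because it contains `1` and
is closed under multiplication by the coordinates (`X_mul_zlin_pow_mem`, `iSup_modelUkv`).

For the submodules, `conf_rsq_pow_mul` shows that the only obstruction to `conf` preserving the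
ideal `(r²ʲ)` carries the factor `j (n - 2E₀ - 2j)`. So for `E₀ = n/2 - j` the ideal is a submodule,
and it is the sum of the pieces with `k ≥ j` (`iSup_modelUkv_add`).

Conversely, let `p` be an element of least degree `d` of a submodule, subject to lying outside a
given subspace `W`. If `d = 0`, the submodule is everything. Otherwise all `conf E₀ a p` lie in `W`,
and contracting them with `xᵢ` and with `∂ᵢ` gives `½ r²Δp - d (d - 1 + E₀) p` and `½ (n - d - 2E₀)
Δp`. For `W = 0` this forces `p` to be a multiple of some `r²ᵐ` with `E₀ = n/2 - m` (`singular`),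
hence irreducibility away from these values. For `W = (r²ʲ)` it puts `p` into `W` after all, so
`(r²ʲ)` is the largest proper submodule (`GStable.le_rsqMultiples`). Positivity of `E₀` keeps `d - 1
+ E₀` nonzero and bounds `j` by `(n-1)/2`. -/

noncomputable section

/-! ### Differential operators on polynomials and their commutation relations. -/

namespace PolyOp

open MvPolynomial Matrix

set_option linter.unusedSectionVars false

variable {σ : Type*} [Fintype σ] [DecidableEq σ]

/-- The linear form `∑ aᵢ xᵢ`. -/
def lin : (σ → ℂ) →ₗ[ℂ] MvPolynomial σ ℂ where
  toFun a := ∑ i, C (a i) * X i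
  map_add' a b := by simp [add_mul, Finset.sum_add_distrib]
  map_smul' c a := by simp [Finset.smul_sum, smul_eq_C_mul, mul_assoc]

/-- The directional derivative `∑ aᵢ ∂ᵢ`. -/
def dir (a : σ → ℂ) : Derivation ℂ (MvPolynomial σ ℂ) (MvPolynomial σ ℂ) :=
  mkDerivation ℂ (fun i => C (a i))

/-- The Euler operator `∑ xᵢ ∂ᵢ`. -/
def euler : Derivation ℂ (MvPolynomial σ ℂ) (MvPolynomial σ ℂ) := mkDerivation ℂ X

/-- The linear vector field `∑ Aᵢⱼ xᵢ ∂ⱼ`. -/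
def vf (A : Matrix σ σ ℂ) : Derivation ℂ (MvPolynomial σ ℂ) (MvPolynomial σ ℂ) :=
  mkDerivation ℂ (fun j => lin (A.col j))

/-- The Laplacian `∑ ∂ᵢ²`. -/
def lap : MvPolynomial σ ℂ →ₗ[ℂ] MvPolynomial σ ℂ :=
  ∑ i, (pderiv i : Derivation ℂ (MvPolynomial σ ℂ) (MvPolynomial σ ℂ)).toLinearMap ∘ₗ
    (pderiv i : Derivation ℂ (MvPolynomial σ ℂ) (MvPolynomial σ ℂ)).toLinearMap

/-- The quadratic form `∑ xᵢ²`. -/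
def rsq : MvPolynomial σ ℂ := ∑ i, X i ^ 2

lemma lap_apply (p : MvPolynomial σ ℂ) : lap p = ∑ i, pderiv i (pderiv i p) := by
  simp [lap]

@[simp] lemma dir_X (a : σ → ℂ) (i : σ) : dir a (X i) = C (a i) := mkDerivation_X _ _ _

@[simp] lemma euler_X (i : σ) : euler (X i) = (X i : MvPolynomial σ ℂ) := mkDerivation_X _ _ _

@[simp] lemma vf_X (A : Matrix σ σ ℂ) (i : σ) : vf A (X i) = lin (A.col i) := mkDerivation_X _ _ _

lemma lin_apply (a : σ → ℂ) : lin a = ∑ i, C (a i) * X i := rfl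

@[simp] lemma lin_single (i : σ) : lin (Pi.single i 1) = (X i : MvPolynomial σ ℂ) := by
  rw [lin_apply, Finset.sum_eq_single i] <;> simp +contextual

lemma derivation_apply_eq_sum (d : Derivation ℂ (MvPolynomial σ ℂ) (MvPolynomial σ ℂ))
    (p : MvPolynomial σ ℂ) : d p = ∑ i, d (X i) * pderiv i p := by
  have h : ∀ q, (∑ i, (d (X i) : MvPolynomial σ ℂ) • pderiv i :
      Derivation ℂ (MvPolynomial σ ℂ) (MvPolynomial σ ℂ)) q = ∑ i, d (X i) * pderiv i q := by
    intro q
    have := congrFun (map_sum (Derivation.coeFnAddMonoidHom (R := ℂ) (A := MvPolynomial σ ℂ)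
      (M := MvPolynomial σ ℂ)) (fun i => (d (X i) : MvPolynomial σ ℂ) • pderiv i) Finset.univ) q
    rw [Finset.sum_apply] at this
    exact this
  rw [← h]
  congr 1
  apply derivation_ext
  intro i
  rw [h, Finset.sum_eq_single i]
  · simp
  · intro j _ hj
    rw [pderiv_X_of_ne hj.symm, mul_zero]
  · simp

lemma dir_apply (a : σ → ℂ) (p : MvPolynomial σ ℂ) : dir a p = ∑ i, C (a i) * pderiv i p := by
  rw [derivation_apply_eq_sum (dir a)]
  simp

@[simp] lemma dir_single (i : σ) : dir (Pi.single i 1) = (pderiv i : Derivation ℂ _ _) := by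
  apply derivation_ext
  intro j
  rw [dir_X, pderiv_X]
  by_cases h : i = j
  · subst h; simp
  · simp [Ne.symm h]

lemma euler_apply (p : MvPolynomial σ ℂ) : euler p = ∑ i, X i * pderiv i p := by
  rw [derivation_apply_eq_sum euler]
  simp

@[simp] lemma dir_add (a b : σ → ℂ) (p : MvPolynomial σ ℂ) :
    dir (a + b) p = dir a p + dir b p := by
  simp [dir_apply, add_mul, Finset.sum_add_distrib]

@[simp] lemma dir_sub (a b : σ → ℂ) (p : MvPolynomial σ ℂ) :
    dir (a - b) p = dir a p - dir b p := by
  simp [dir_apply, sub_mul, Finset.sum_sub_distrib]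

@[simp] lemma dir_smul (c : ℂ) (a : σ → ℂ) (p : MvPolynomial σ ℂ) :
    dir (c • a) p = C c * dir a p := by
  simp [dir_apply, Finset.mul_sum, mul_assoc]

lemma vf_apply (A : Matrix σ σ ℂ) (p : MvPolynomial σ ℂ) :
    vf A p = ∑ j, lin (A.col j) * pderiv j p := by
  rw [derivation_apply_eq_sum (vf A)]
  simp

lemma col_add' (A B : Matrix σ σ ℂ) (j : σ) : (A + B).col j = A.col j + B.col j := rfl

@[simp] lemma vf_add (A B : Matrix σ σ ℂ) (p : MvPolynomial σ ℂ) :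
    vf (A + B) p = vf A p + vf B p := by
  simp [vf_apply, col_add', add_mul, Finset.sum_add_distrib]

@[simp] lemma vf_smul (c : ℂ) (A : Matrix σ σ ℂ) (p : MvPolynomial σ ℂ) :
    vf (c • A) p = C c * vf A p := by
  have h : ∀ j, (c • A).col j = c • A.col j := fun j => rfl
  simp [vf_apply, h, Finset.mul_sum, smul_eq_C_mul, mul_assoc]

@[simp] lemma vf_zero (p : MvPolynomial σ ℂ) : vf (0 : Matrix σ σ ℂ) p = 0 := by
  have := vf_smul 0 (0 : Matrix σ σ ℂ) p
  simpa using this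

@[simp] lemma vf_neg (A : Matrix σ σ ℂ) (p : MvPolynomial σ ℂ) : vf (-A) p = - vf A p := by
  have := vf_smul (-1) A p
  simpa using this

@[simp] lemma vf_sub (A B : Matrix σ σ ℂ) (p : MvPolynomial σ ℂ) :
    vf (A - B) p = vf A p - vf B p := by
  simp [sub_eq_add_neg]

lemma vf_vecMulVec (a b : σ → ℂ) (p : MvPolynomial σ ℂ) :
    vf (vecMulVec a b) p = lin a * dir b p := by
  have h : ∀ j, (vecMulVec a b).col j = b j • a := fun j => by
    ext i; simp [vecMulVec_apply, mul_comm]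
  simp only [vf_apply, dir_apply, h, Finset.mul_sum, map_smul, smul_eq_C_mul]
  exact Finset.sum_congr rfl fun _ _ => by ring

lemma dir_lin (a b : σ → ℂ) : dir a (lin b) = C (a ⬝ᵥ b) := by
  simp [lin_apply, dotProduct, mul_comm]

lemma euler_lin (b : σ → ℂ) : euler (lin b) = lin b := by
  simp [lin_apply]

lemma vf_lin (A : Matrix σ σ ℂ) (b : σ → ℂ) : vf A (lin b) = lin (A *ᵥ b) := by
  have : A *ᵥ b = ∑ i, b i • A.col i := by
    ext j; simp [mulVec, dotProduct, mul_comm]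
  rw [this, map_sum]
  simp only [lin_apply b, map_sum, Derivation.leibniz, vf_X, derivation_C, add_zero,
    map_smul, smul_eq_C_mul, smul_eq_mul, mul_zero]

lemma dir_lin_mul (a b : σ → ℂ) (p : MvPolynomial σ ℂ) :
    dir a (lin b * p) = C (a ⬝ᵥ b) * p + lin b * dir a p := by
  simp [dir_lin]; ring

lemma euler_lin_mul (b : σ → ℂ) (p : MvPolynomial σ ℂ) :
    euler (lin b * p) = lin b * p + lin b * euler p := by
  simp [euler_lin]; ring

lemma vf_lin_mul (A : Matrix σ σ ℂ) (b : σ → ℂ) (p : MvPolynomial σ ℂ) :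
    vf A (lin b * p) = lin (A *ᵥ b) * p + lin b * vf A p := by
  simp [vf_lin]; ring

lemma lap_X_mul (i : σ) (p : MvPolynomial σ ℂ) :
    lap (X i * p) = X i * lap p + 2 * pderiv i p := by
  have h : ∀ j, pderiv j (pderiv j (X i * p)) = X i * pderiv j (pderiv j p) +
      if j = i then 2 * pderiv i p else 0 := by
    intro j
    by_cases hj : j = i
    · subst hj; simp; ring
    · simp [hj, pderiv_X_of_ne (Ne.symm hj)]
  simp only [lap_apply, h]
  simp [ Finset.sum_add_distrib, Finset.mul_sum]

lemma lap_C_mul (c : ℂ) (p : MvPolynomial σ ℂ) : lap (C c * p) = C c * lap p := by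
  rw [← smul_eq_C_mul, map_smul, smul_eq_C_mul]

lemma deriv_C_mul (d : Derivation ℂ (MvPolynomial σ ℂ) (MvPolynomial σ ℂ)) (c : ℂ)
    (p : MvPolynomial σ ℂ) : d (C c * p) = C c * d p := by
  simp

lemma lap_lin_mul (a : σ → ℂ) (p : MvPolynomial σ ℂ) :
    lap (lin a * p) = lin a * lap p + 2 * dir a p := by
  simp only [lin_apply, Finset.sum_mul, map_sum, mul_assoc, lap_C_mul, lap_X_mul, mul_add,
    Finset.sum_add_distrib, dir_apply, Finset.mul_sum]
  congr 1
  exact Finset.sum_congr rfl fun _ _ => by ring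

/-- Two derivations whose commutator agrees with a third one on the variables. -/
lemma commutator_eq {d₁ d₂ d₃ : Derivation ℂ (MvPolynomial σ ℂ) (MvPolynomial σ ℂ)}
    (h : ∀ i, d₁ (d₂ (X i)) - d₂ (d₁ (X i)) = d₃ (X i)) (p : MvPolynomial σ ℂ) :
    d₁ (d₂ p) - d₂ (d₁ p) = d₃ p := by
  have : ⁅d₁, d₂⁆ = d₃ := derivation_ext fun i => by rw [Derivation.commutator_apply, h]
  rw [← this, Derivation.commutator_apply]

lemma dir_dir (a b : σ → ℂ) (p : MvPolynomial σ ℂ) : dir a (dir b p) = dir b (dir a p) := by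
  have := commutator_eq (d₁ := dir a) (d₂ := dir b) (d₃ := 0) (fun i => by simp) p
  exact sub_eq_zero.1 this

lemma euler_dir (a : σ → ℂ) (p : MvPolynomial σ ℂ) :
    euler (dir a p) = dir a (euler p) - dir a p := by
  have := commutator_eq (d₁ := euler) (d₂ := dir a) (d₃ := - dir a) (fun i => by simp) p
  rw [Derivation.neg_apply] at this
  linear_combination this

lemma vf_dir (A : Matrix σ σ ℂ) (a : σ → ℂ) (p : MvPolynomial σ ℂ) :
    vf A (dir a p) = dir a (vf A p) - dir (a ᵥ* A) p := by
  have := commutator_eq (d₁ := vf A) (d₂ := dir a) (d₃ := - dir (a ᵥ* A)) (fun i => by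
    simp only [vf_X, dir_X, dir_lin, derivation_C, zero_sub, Derivation.neg_apply]; rfl) p
  rw [Derivation.neg_apply] at this
  linear_combination this

lemma vf_euler (A : Matrix σ σ ℂ) (p : MvPolynomial σ ℂ) : vf A (euler p) = euler (vf A p) := by
  have := commutator_eq (d₁ := vf A) (d₂ := euler) (d₃ := 0) (fun i => by simp [euler_lin]) p
  exact sub_eq_zero.1 this

lemma vf_vf (A B : Matrix σ σ ℂ) (p : MvPolynomial σ ℂ) :
    vf A (vf B p) - vf B (vf A p) = vf (A * B - B * A) p := by
  apply commutator_eq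
  intro i
  have h : (A * B - B * A).col i = A *ᵥ B.col i - B *ᵥ A.col i := by
    ext j; simp [mul_apply, mulVec, dotProduct]
  simp [vf_lin, h]

lemma lap_eq_dir (p : MvPolynomial σ ℂ) :
    lap p = ∑ i, dir (Pi.single i 1) (dir (Pi.single i 1) p) := by
  simp [lap_apply]

lemma dir_lap (a : σ → ℂ) (p : MvPolynomial σ ℂ) : dir a (lap p) = lap (dir a p) := by
  simp only [lap_eq_dir, map_sum]
  refine Finset.sum_congr rfl fun i _ => ?_
  rw [dir_dir a, dir_dir a]

lemma euler_lap (p : MvPolynomial σ ℂ) : euler (lap p) = lap (euler p) - 2 * lap p := by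
  simp only [lap_eq_dir, map_sum, Finset.mul_sum, ← Finset.sum_sub_distrib]
  refine Finset.sum_congr rfl fun i _ => ?_
  rw [euler_dir, euler_dir, map_sub]
  ring

/-- The commutator is `-2 ∑ Aᵢⱼ ∂ⱼ∂ᵢ`, a skew matrix contracted with symmetric second derivatives,
hence zero. -/
lemma vf_lap {A : Matrix σ σ ℂ} (hA : Aᵀ = -A) (p : MvPolynomial σ ℂ) :
    vf A (lap p) = lap (vf A p) := by
  have h1 : vf A (lap p) = lap (vf A p) -
      2 * ∑ i, dir (Pi.single i 1 ᵥ* A) (dir (Pi.single i 1) p) := by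
    simp only [lap_eq_dir, map_sum, Finset.mul_sum, ← Finset.sum_sub_distrib]
    refine Finset.sum_congr rfl fun i _ => ?_
    rw [vf_dir, vf_dir, map_sub, dir_dir (Pi.single i 1 ᵥ* A)]
    ring
  have h2 : ∑ i, dir (Pi.single i 1 ᵥ* A) (dir (Pi.single i 1) p) =
      ∑ i, ∑ j, C (A i j) * pderiv j (pderiv i p) := by
    simp [dir_apply (Matrix.row _ _)]
  have h3 : ∑ i, ∑ j, C (A i j) * pderiv j (pderiv i p) =
      - ∑ i, ∑ j, C (A i j) * pderiv j (pderiv i p) := by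
    conv_lhs => rw [Finset.sum_comm]
    rw [← Finset.sum_neg_distrib]
    refine Finset.sum_congr rfl fun j _ => ?_
    rw [← Finset.sum_neg_distrib]
    refine Finset.sum_congr rfl fun i _ => ?_
    have h := congrFun (congrFun hA j) i
    have hc : pderiv j (pderiv i p) = pderiv i (pderiv j p) := by
      simpa using dir_dir (Pi.single j 1) (Pi.single i 1) p
    rw [hc]
    simp only [transpose_apply] at h
    simp [h]
  have h4 : ∑ i, ∑ j, C (A i j) * pderiv j (pderiv i p) = 0 := self_eq_neg.1 h3
  rw [h1, h2, h4]
  simp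

/-- The operator `½ (a·x) Δ - (E + s) ∂ₐ`. -/
def conf (s : ℂ) (a : σ → ℂ) (p : MvPolynomial σ ℂ) : MvPolynomial σ ℂ :=
  C (1 / 2) * lin a * lap p - (euler (dir a p) + C s * dir a p)

lemma half_two : (C (1 / 2) : MvPolynomial σ ℂ) * 2 = 1 := by
  rw [show (2 : MvPolynomial σ ℂ) = C 2 from rfl, ← C_mul]; norm_num

/-- This is the bracket of `p⁺` with `p⁻`: a rotation in the plane of `a` and `b`, plus a multiple
of the weight operator `E + s`. -/
lemma conf_lin_mul (s : ℂ) (a b : σ → ℂ) (p : MvPolynomial σ ℂ) :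
    conf s a (lin b * p) = lin b * conf s a p + lin a * dir b p - lin b * dir a p -
      C (a ⬝ᵥ b) * (euler p + C s * p) := by
  simp only [conf, dir_lin_mul, lap_lin_mul, map_add, euler_lin_mul, deriv_C_mul]
  linear_combination (lin a * dir b p) * (half_two (σ := σ))

/-- Reflects that `p⁺` is abelian. -/
lemma conf_comm (s : ℂ) (a b : σ → ℂ) (p : MvPolynomial σ ℂ) :
    conf s a (conf s b p) = conf s b (conf s a p) := by
  simp only [conf, map_sub, map_add, mul_assoc, deriv_C_mul, lap_C_mul, dir_lin_mul, lap_lin_mul,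
    euler_lin_mul, euler_dir, euler_lap, dir_lap, dir_dir b a, dotProduct_comm b a]
  linear_combination C (1 / 2) * (lin a * lap (dir b p) - lin b * lap (dir a p)) *
    (half_two (σ := σ))

lemma conf_add_left (s : ℂ) (a b : σ → ℂ) (p : MvPolynomial σ ℂ) :
    conf s (a + b) p = conf s a p + conf s b p := by
  simp only [conf, map_add, dir_add]; ring

lemma conf_smul_left (s c : ℂ) (a : σ → ℂ) (p : MvPolynomial σ ℂ) :
    conf s (c • a) p = C c * conf s a p := by
  simp only [conf, map_smul, dir_smul, smul_eq_C_mul, deriv_C_mul]; ring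

lemma conf_zero_left (s : ℂ) (p : MvPolynomial σ ℂ) : conf s 0 p = 0 := by
  simpa using conf_smul_left s 0 0 p

lemma conf_sub_left (s : ℂ) (a b : σ → ℂ) (p : MvPolynomial σ ℂ) :
    conf s (a - b) p = conf s a p - conf s b p := by
  simp only [conf, map_sub, dir_sub]; ring

lemma conf_add (s : ℂ) (a : σ → ℂ) (p q : MvPolynomial σ ℂ) :
    conf s a (p + q) = conf s a p + conf s a q := by
  simp only [conf, map_add]; ring

lemma conf_C_mul (s c : ℂ) (a : σ → ℂ) (p : MvPolynomial σ ℂ) :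
    conf s a (C c * p) = C c * conf s a p := by
  simp only [conf, lap_C_mul, deriv_C_mul]; ring

lemma vf_conf {A : Matrix σ σ ℂ} (hA : Aᵀ = -A) (s : ℂ) (a : σ → ℂ) (p : MvPolynomial σ ℂ) :
    vf A (conf s a p) = conf s a (vf A p) + conf s (A *ᵥ a) p := by
  have h : a ᵥ* A = - (A *ᵥ a) := by
    rw [← mulVec_transpose, hA, neg_mulVec]
  have h' (a : σ → ℂ) (p) : dir (-a) p = - dir a p := by simpa using dir_smul (-1) a p
  simp only [conf, mul_assoc, map_sub, map_add, deriv_C_mul, vf_lin_mul, vf_lap hA, vf_euler,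
    vf_dir, h, h', map_neg]
  ring

lemma euler_conf (s : ℂ) (a : σ → ℂ) (p : MvPolynomial σ ℂ) :
    euler (conf s a p) = conf s a (euler p) - conf s a p := by
  simp only [conf, mul_assoc, map_sub, map_add, deriv_C_mul, euler_lin_mul, euler_lap, euler_dir]
  ring

end PolyOp

end

/-! ### The representation of the complexified `so(2,n)` on polynomials. -/

noncomputable section

attribute [local instance 100] LieRing.ofAssociativeRing

namespace SO2n

open Complex Matrix PolyOp

/-- The component in `ℂⁿ` of `A e₁`. -/
def lowerPart (n : ℕ) : G n →ₗ[ℂ] Fin n → ℂ where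
  toFun A i := A.1 (Sum.inr i) (Sum.inl 0) + I * A.1 (Sum.inr i) (Sum.inl 1)
  map_add' A B := by ext i; simp; ring
  map_smul' c A := by ext i; simp; ring

/-- The component in `ℂⁿ` of `A e₋₁`. -/
def upperPart (n : ℕ) : G n →ₗ[ℂ] Fin n → ℂ where
  toFun A i := 1 / 2 * (A.1 (Sum.inr i) (Sum.inl 0) - I * A.1 (Sum.inr i) (Sum.inl 1))
  map_add' A B := by ext i; simp; ring
  map_smul' c A := by ext i; simp; ring

/-- The `so(n)`-block of `A`. -/
def rotPart (n : ℕ) : G n →ₗ[ℂ] Matrix (Fin n) (Fin n) ℂ where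
  toFun A := A.1.toBlocks₂₂
  map_add' _ _ := rfl
  map_smul' _ _ := rfl

variable {n : ℕ}

lemma entry_symm (A : G n) (p q : Fin 2 ⊕ Fin n) :
    A.1 q p * Sum.elim (fun _ => 1) (fun _ => -1) q =
      -(Sum.elim (fun _ => 1) (fun _ => -1) p * A.1 p q) := by
  have h := congrFun (congrFun ((mem_so' A.1).1 A.2) p) q
  simpa [eta, LieAlgebra.Orthogonal.indefiniteDiagonal, Matrix.mul_diagonal,
        Matrix.diagonal_mul] using h

lemma entry_inl_inr (A : G n) (a : Fin 2) (i : Fin n) :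
    A.1 (Sum.inl a) (Sum.inr i) = A.1 (Sum.inr i) (Sum.inl a) := by
  simpa using (entry_symm A (Sum.inl a) (Sum.inr i)).symm

lemma entry_inl_self (A : G n) (a : Fin 2) : A.1 (Sum.inl a) (Sum.inl a) = 0 := by
  have := entry_symm A (Sum.inl a) (Sum.inl a)
  simpa [self_eq_neg] using this

lemma entry_one_zero (A : G n) :
    A.1 (Sum.inl 1) (Sum.inl 0) = -A.1 (Sum.inl 0) (Sum.inl 1) := by
  simpa using entry_symm A (Sum.inl 0) (Sum.inl 1)

lemma rotPart_transpose (A : G n) : (rotPart n A)ᵀ = -rotPart n A := by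
  ext i j
  have := entry_symm A (Sum.inr i) (Sum.inr j)
  simp at this
  simp [rotPart, toBlocks₂₂, ← this]

lemma weight₁_apply (A : G n) : weight₁ n A = I * A.1 (Sum.inl 0) (Sum.inl 1) := by
  change (A.1 *ᵥ e n 1) (Sum.inl 0) = _
  rw [e_one]
  simp [Matrix.mulVec, dotProduct, entry_inl_self, mul_comm]

lemma coe_lie_apply (A B : G n) (p q : Fin 2 ⊕ Fin n) :
    (⁅A, B⁆ : G n).1 p q = (A.1 * B.1) p q - (B.1 * A.1) p q := by
  rw [LieSubalgebra.coe_bracket, Ring.lie_def, Matrix.sub_apply]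

/-- This and the next three lemmas write the bracket in the decomposition `p⁻ ⊕ p⁺ ⊕ so(2) ⊕ so(n)`.
Brackets of `p⁺` with `p⁻` contribute the dot products here and the `vecMulVec` terms in
`rotPart_lie`. -/
lemma weight₁_lie (A B : G n) : weight₁ n ⁅A, B⁆ =
    upperPart n A ⬝ᵥ lowerPart n B - upperPart n B ⬝ᵥ lowerPart n A := by
  simp only [weight₁_apply, coe_lie_apply, mul_apply, Fintype.sum_sum_type, Fin.sum_univ_two,
    entry_inl_self, entry_inl_inr, dotProduct, upperPart, lowerPart,
    LinearMap.coe_mk, AddHom.coe_mk, mul_sub, mul_add, Finset.mul_sum]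
  simp only [add_sub_add_comm, ← Finset.sum_sub_distrib]
  rw [← sub_eq_zero, add_sub_assoc, ← Finset.sum_sub_distrib, Finset.sum_eq_zero]
  · ring
  · intro i _
    ring

lemma lowerPart_lie (A B : G n) : lowerPart n ⁅A, B⁆ =
    weight₁ n B • lowerPart n A - weight₁ n A • lowerPart n B +
      rotPart n A *ᵥ lowerPart n B - rotPart n B *ᵥ lowerPart n A := by
  ext i
  simp only [weight₁_apply, coe_lie_apply, mul_apply, Fintype.sum_sum_type, Fin.sum_univ_two,
    entry_inl_self, entry_one_zero, lowerPart, rotPart, mulVec, dotProduct,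
    toBlocks₂₂, Matrix.of_apply, Pi.add_apply, Pi.sub_apply, Pi.smul_apply, smul_eq_mul,
    LinearMap.coe_mk, AddHom.coe_mk, mul_add, Finset.sum_add_distrib]
  simp only [mul_left_comm _ I, ← Finset.mul_sum]
  linear_combination -(A.1 (Sum.inr i) (Sum.inl 1) * B.1 (Sum.inl 0) (Sum.inl 1) -
    B.1 (Sum.inr i) (Sum.inl 1) * A.1 (Sum.inl 0) (Sum.inl 1)) * I_sq

lemma upperPart_lie (A B : G n) : upperPart n ⁅A, B⁆ =
    weight₁ n A • upperPart n B - weight₁ n B • upperPart n A +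
      rotPart n A *ᵥ upperPart n B - rotPart n B *ᵥ upperPart n A := by
  ext i
  simp only [weight₁_apply, coe_lie_apply, mul_apply, Fintype.sum_sum_type, Fin.sum_univ_two,
    entry_inl_self, entry_one_zero, upperPart, rotPart, mulVec, dotProduct,
    toBlocks₂₂, Matrix.of_apply, Pi.add_apply, Pi.sub_apply, Pi.smul_apply, smul_eq_mul,
    LinearMap.coe_mk, AddHom.coe_mk]
  have h (a x y : Fin n → ℂ) : ∑ j, a j * (1 / 2 * (x j - I * y j)) =
      1 / 2 * (∑ j, a j * x j - I * ∑ j, a j * y j) := by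
    rw [Finset.mul_sum, ← Finset.sum_sub_distrib, Finset.mul_sum]
    exact Finset.sum_congr rfl fun _ _ => by ring
  simp only [h]
  linear_combination (A.1 (Sum.inr i) (Sum.inl 1) * B.1 (Sum.inl 0) (Sum.inl 1) -
    B.1 (Sum.inr i) (Sum.inl 1) * A.1 (Sum.inl 0) (Sum.inl 1)) * (-I_sq / 2)

lemma rotPart_lie (A B : G n) : rotPart n ⁅A, B⁆ =
    rotPart n A * rotPart n B - rotPart n B * rotPart n A +
      vecMulVec (upperPart n A) (lowerPart n B) - vecMulVec (lowerPart n B) (upperPart n A) +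
      vecMulVec (lowerPart n A) (upperPart n B) - vecMulVec (upperPart n B) (lowerPart n A) := by
  ext i j
  have h : rotPart n ⁅A, B⁆ i j = (⁅A, B⁆ : G n).1 (Sum.inr i) (Sum.inr j) := rfl
  rw [h]
  simp only [coe_lie_apply, mul_apply, Fintype.sum_sum_type, Fin.sum_univ_two,
    entry_inl_inr, upperPart, lowerPart, rotPart,
    toBlocks₂₂, Matrix.of_apply, Matrix.add_apply, Matrix.sub_apply, vecMulVec_apply,
    LinearMap.coe_mk, AddHom.coe_mk]
  linear_combination (A.1 (Sum.inr i) (Sum.inl 1) * B.1 (Sum.inr j) (Sum.inl 1) -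
    B.1 (Sum.inr i) (Sum.inl 1) * A.1 (Sum.inr j) (Sum.inl 1)) * I_sq

/-- The action of a single element of the complexified `so(2,n)` on polynomials. -/
def repEnd (E₀ : ℂ) (A : G n) : Module.End ℂ (MvPolynomial (Fin n) ℂ) where
  toFun p := lin (lowerPart n A) * p + conf E₀ (upperPart n A) p -
    MvPolynomial.C (weight₁ n A) * (euler p + MvPolynomial.C E₀ * p) + vf (rotPart n A) p
  map_add' p q := by simp only [map_add, conf_add]; ring
  map_smul' c p := by
    simp only [MvPolynomial.smul_eq_C_mul, conf_C_mul, deriv_C_mul, RingHom.id_apply]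
    ring

lemma repEnd_apply (E₀ : ℂ) (A : G n) (p : MvPolynomial (Fin n) ℂ) :
    repEnd E₀ A p = lin (lowerPart n A) * p + conf E₀ (upperPart n A) p -
      MvPolynomial.C (weight₁ n A) * (euler p + MvPolynomial.C E₀ * p) + vf (rotPart n A) p := rfl

lemma repEnd_add (E₀ : ℂ) (A B : G n) : repEnd E₀ (A + B) = repEnd E₀ A + repEnd E₀ B := by
  refine LinearMap.ext fun p => ?_
  simp only [repEnd_apply, LinearMap.add_apply, map_add, conf_add_left, vf_add]
  ring

lemma repEnd_smul (E₀ c : ℂ) (A : G n) : repEnd E₀ (c • A) = c • repEnd E₀ A := by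
  refine LinearMap.ext fun p => ?_
  simp only [repEnd_apply, LinearMap.smul_apply, map_smul, conf_smul_left, vf_smul,
    MvPolynomial.smul_eq_C_mul, smul_eq_mul, map_mul]
  ring

/-- Both sides are expanded with the commutation relations of the four kinds of operators. What
remains after `simp` is the commutativity of `p⁺` and the commutator `hv` of the two rotations. -/
lemma repEnd_lie (E₀ : ℂ) (A B : G n) (p : MvPolynomial (Fin n) ℂ) :
    repEnd E₀ ⁅A, B⁆ p = repEnd E₀ A (repEnd E₀ B p) - repEnd E₀ B (repEnd E₀ A p) := by
  have hv := vf_vf (rotPart n A) (rotPart n B) p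
  rw [vf_sub] at hv
  simp only [repEnd_apply, weight₁_lie, lowerPart_lie, upperPart_lie, rotPart_lie, map_add,
    map_sub, map_smul, conf_add_left, conf_sub_left, conf_smul_left, vf_add, vf_sub,
    vf_vecMulVec, conf_add, conf_C_mul, deriv_C_mul, vf_lin_mul, euler_lin_mul,
    conf_lin_mul, euler_conf, vf_conf (rotPart_transpose _), vf_euler,
    MvPolynomial.smul_eq_C_mul]
  rw [conf_comm _ (upperPart n A) (upperPart n B)]
  linear_combination -hv

/-- The representation of the complexified `so(2,n)` on polynomials in which `p⁻` acts by
multiplication with linear forms and `1` has weight `-E₀`. -/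
def rep (n : ℕ) (E₀ : ℝ) : G n →ₗ⁅ℂ⁆ Module.End ℂ (MvPolynomial (Fin n) ℂ) where
  toFun := repEnd E₀
  map_add' := repEnd_add _
  map_smul' := repEnd_smul _
  map_lie' := fun {A B} => LinearMap.ext fun p => repEnd_lie _ A B p

lemma rep_apply (E₀ : ℝ) (A : G n) (p : MvPolynomial (Fin n) ℂ) :
    rep n E₀ A p = lin (lowerPart n A) * p + conf E₀ (upperPart n A) p -
      MvPolynomial.C (weight₁ n A) * (euler p + MvPolynomial.C (E₀ : ℂ) * p) +
      vf (rotPart n A) p := rfl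

end SO2n

end

/-! ### Coordinates on `p⁺`, `p⁻`, `k` and `q`, and the quadratic element `Z`. -/

noncomputable section

attribute [local instance 100] LieRing.ofAssociativeRing

namespace SO2n

open Complex Matrix PolyOp

variable {n : ℕ}

lemma ext_parts {A B : G n} (h₁ : lowerPart n A = lowerPart n B)
    (h₂ : upperPart n A = upperPart n B) (h₃ : weight₁ n A = weight₁ n B)
    (h₄ : rotPart n A = rotPart n B) : A = B := by
  have hl (i) := congrFun h₁ i
  have hu (i) := congrFun h₂ i
  simp only [lowerPart, upperPart, LinearMap.coe_mk, AddHom.coe_mk] at hl hu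
  have h0 (i) : A.1 (Sum.inr i) (Sum.inl 0) = B.1 (Sum.inr i) (Sum.inl 0) := by
    linear_combination (hl i) / 2 + hu i
  have h1 (i) : A.1 (Sum.inr i) (Sum.inl 1) = B.1 (Sum.inr i) (Sum.inl 1) := by
    refine mul_left_cancel₀ I_ne_zero ?_
    linear_combination (hl i) / 2 - hu i
  have h01 : A.1 (Sum.inl 0) (Sum.inl 1) = B.1 (Sum.inl 0) (Sum.inl 1) := by
    rw [weight₁_apply, weight₁_apply] at h₃
    exact mul_left_cancel₀ I_ne_zero h₃
  have h10 : A.1 (Sum.inl 1) (Sum.inl 0) = B.1 (Sum.inl 1) (Sum.inl 0) := by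
    rw [entry_one_zero, entry_one_zero, h01]
  have hr (i j) : A.1 (Sum.inr i) (Sum.inr j) = B.1 (Sum.inr i) (Sum.inr j) :=
    congrFun (congrFun h₄ i) j
  refine Subtype.ext (Matrix.ext ?_)
  rintro (a | i) (b | j)
  · fin_cases a <;> fin_cases b <;> simp [entry_inl_self, h01, h10]
  · fin_cases a <;> simp [entry_inl_inr, h0, h1]
  · fin_cases b <;> simp [h0, h1]
  · exact hr i j

lemma wedge_apply (u w : Fin 2 ⊕ Fin n → ℂ) (p q : Fin 2 ⊕ Fin n) :
    (wedge u w).1 p q = (w p * u q - u p * w q) * Sum.elim (fun _ => 1) (fun _ => -1) q := by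
  simp [wedge, wedgeMatrix, eta, LieAlgebra.Orthogonal.indefiniteDiagonal, vecMulVec_apply,
    vecMul_diagonal]
  ring

lemma e_neg_one (n : ℕ) : e n (-1) = Sum.elim ![1 / 2, -I / 2] 0 := by
  ext (i | i)
  · fin_cases i
    · simp [e, f]
    · simp [e, f]; ring
  · have h1 : ¬ (-1 : ℤ) = (i : ℤ) + 1 := by omega
    have h2 : ¬ (0 : ℤ) = (i : ℤ) + 1 := by omega
    simp [e, f, h1, h2]

/-- The elements of `p⁻`. -/
def lowering (n : ℕ) (a : Fin n → ℂ) : G n := wedge (e n (-1)) (Sum.elim 0 a)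

/-- The elements of `p⁺`. -/
def raising (n : ℕ) : (Fin n → ℂ) →ₗ[ℂ] G n where
  toFun a := wedge (e n 1) (Sum.elim 0 a)
  map_add' a b := by
    refine Subtype.ext (Matrix.ext ?_)
    rintro (p | p) (q | q) <;> simp [wedge_apply] <;> ring
  map_smul' c a := by
    refine Subtype.ext (Matrix.ext ?_)
    rintro (p | p) (q | q) <;> simp [wedge_apply] <;> ring

lemma lowerPart_lowering (a : Fin n → ℂ) : lowerPart n (lowering n a) = a := by
  ext i
  simp only [lowering, lowerPart, wedge_apply, e_neg_one, LinearMap.coe_mk, AddHom.coe_mk]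
  simp
  linear_combination (-a i / 2) * I_sq

lemma upperPart_lowering (a : Fin n → ℂ) : upperPart n (lowering n a) = 0 := by
  ext i
  simp only [lowering, upperPart, wedge_apply, e_neg_one, LinearMap.coe_mk, AddHom.coe_mk]
  simp
  linear_combination (a i / 2) * I_sq

lemma weight₁_lowering (a : Fin n → ℂ) : weight₁ n (lowering n a) = 0 := by
  simp [lowering, weight₁_apply, wedge_apply]

lemma rotPart_lowering (a : Fin n → ℂ) : rotPart n (lowering n a) = 0 := by
  ext i j
  simp [lowering, rotPart, toBlocks₂₂, wedge_apply, e_neg_one]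

lemma upperPart_raising (a : Fin n → ℂ) : upperPart n (raising n a) = a := by
  ext i
  simp only [raising, upperPart, wedge_apply, e_one, LinearMap.coe_mk, AddHom.coe_mk]
  simp
  linear_combination (-a i / 2) * I_sq

lemma lowerPart_raising (a : Fin n → ℂ) : lowerPart n (raising n a) = 0 := by
  ext i
  simp only [raising, lowerPart, wedge_apply, e_one, LinearMap.coe_mk, AddHom.coe_mk]
  simp
  linear_combination (a i) * I_sq

lemma weight₁_raising (a : Fin n → ℂ) : weight₁ n (raising n a) = 0 := by
  simp [raising, weight₁_apply, wedge_apply]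

lemma rotPart_raising (a : Fin n → ℂ) : rotPart n (raising n a) = 0 := by
  ext i j
  simp [raising, rotPart, toBlocks₂₂, wedge_apply, e_one]

lemma mem_k_iff {A : G n} : A ∈ k n ↔ lowerPart n A = 0 ∧ upperPart n A = 0 := by
  constructor
  · intro hA
    constructor <;> ext i <;> simp [lowerPart, upperPart, (hA 0 i).2, (hA 1 i).2]
  · rintro ⟨h₁, h₂⟩ a i
    have hl := congrFun h₁ i
    have hu := congrFun h₂ i
    simp only [lowerPart, upperPart, LinearMap.coe_mk, AddHom.coe_mk, Pi.zero_apply] at hl hu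
    have h0 : A.1 (Sum.inr i) (Sum.inl 0) = 0 := by linear_combination hl / 2 + hu
    have h1 : A.1 (Sum.inr i) (Sum.inl 1) = 0 := by
      refine mul_left_cancel₀ I_ne_zero ?_
      linear_combination hl / 2 - hu
    rw [entry_inl_inr]
    fin_cases a <;> simp [h0, h1]

/-- The component of `e_j` in `ℂⁿ`. -/
def eVec (n : ℕ) (j : ℤ) : Fin n → ℂ := fun i => e n j (Sum.inr i)

/-- The component of `f_a` in `ℂⁿ`. -/
def fVec (n : ℕ) (a : ℤ) : Fin n → ℂ := fun i => f n a (Sum.inr i)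

lemma fVec_succ (m : Fin n) : fVec n ((m : ℕ) + 1 : ℤ) = Pi.single m 1 := by
  ext i
  simp [fVec, f, Pi.single_apply, Fin.ext_iff, eq_comm]

lemma e_eq_elim (hn : 1 ≤ n) {j : ℤ} (hj : |j| ≠ 1) : e n j = Sum.elim (0 : Fin 2 → ℂ) (eVec n j) := by
  ext (i | i)
  · have key : ∀ a : ℤ, 1 ≤ a → f n a (Sum.inl i) = 0 := by
      intro a ha
      have : ¬ a = (i : ℤ) - 1 := by omega
      simp [f, this]
    simp only [Sum.elim_inl, Pi.zero_apply, e]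
    split_ifs with h0 h1 h2
    · simp [key n (by omega)]
    · simp [key (2 * j - 3) (by grind), key (2 * j - 2) (by grind)]
    · exact absurd (by simp [h2]) hj
    · rw [Pi.smul_apply, Pi.sub_apply, Pi.smul_apply, key (-2 * j - 3) (by grind),
        key (-2 * j - 2) (by grind)]
      simp
  · rfl

lemma eVec_zero : eVec n 0 = I • fVec n n := by
  ext i; simp [eVec, e, fVec]

lemma eVec_pos {j : ℤ} (hj : 2 ≤ j) :
    eVec n j = fVec n (2 * j - 3) + I • fVec n (2 * j - 2) := by
  ext i
  simp [eVec, e, fVec, show j ≠ 0 by omega, show 0 < j by omega]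

lemma eVec_neg {j : ℤ} (hj : 2 ≤ j) :
    eVec n (-j) = (-(1 / 2) : ℂ) • (fVec n (2 * j - 3) - I • fVec n (2 * j - 2)) := by
  ext i
  simp [eVec, e, fVec, show j ≠ 0 by omega, show ¬ j < 0 by omega, show j ≠ 1 by omega]

lemma X_neg_one (hn : 1 ≤ n) {j : ℤ} (hj : |j| ≠ 1) : X n (-1) j = lowering n (eVec n j) := by
  rw [X, lowering, ← e_eq_elim hn hj]

/-- The vectors `e_j` with `|j| ≠ 1` span `ℂⁿ`: each pair `e_j, e_{-j}` recovers two standard basis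
vectors, and for odd `n` the last one comes from `e_0`. -/
lemma raising_mem_pPlus (hn : 1 ≤ n) (a : Fin n → ℂ) : raising n a ∈ pPlus n := by
  have hX : ∀ j ∈ idx n, |j| ≠ 1 → eVec n j ∈ (pPlus n).comap (raising n) := by
    intro j hj hj'
    refine Submodule.subset_span ⟨j, hj, hj', ?_⟩
    rw [X, e_eq_elim hn hj']
    rfl
  have hsingle : ∀ m : Fin n, Pi.single m 1 ∈ (pPlus n).comap (raising n) := by
    intro m
    have hm := m.2
    have hpair : ∀ j : ℤ, 2 ≤ j → 2 * j - 2 ≤ n →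
        fVec n (2 * j - 3) ∈ (pPlus n).comap (raising n) ∧
        fVec n (2 * j - 2) ∈ (pPlus n).comap (raising n) := by
      intro j hj hjn
      have h1 := hX j (by simp only [idx, rk, Finset.mem_filter, Finset.mem_Icc]; omega) (by grind)
      have h2 := hX (-j) (by simp only [idx, rk, Finset.mem_filter, Finset.mem_Icc]; omega)
        (by grind)
      have e1 : fVec n (2 * j - 3) = (1 / 2 : ℂ) • eVec n j - eVec n (-j) := by
        rw [eVec_pos hj, eVec_neg hj]
        ext i; simp; ring
      have e2 : fVec n (2 * j - 2) = (-I) • ((1 / 2 : ℂ) • eVec n j + eVec n (-j)) := by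
        rw [eVec_pos hj, eVec_neg hj]
        ext i; simp
        linear_combination (fVec n (2 * j - 2) i) * I_sq
      rw [e1, e2]
      exact ⟨Submodule.sub_mem _ (Submodule.smul_mem _ _ h1) h2,
        Submodule.smul_mem _ _ (Submodule.add_mem _ (Submodule.smul_mem _ _ h1) h2)⟩
    rw [← fVec_succ]
    -- With `m = 2c` or `m = 2c + 1`, the vector `f_{m+1}` belongs to the pair of index `j = c + 2`,
    -- unless `m` is even and `m + 1 = n`.
    obtain ⟨c, hc | hc⟩ := Nat.even_or_odd' (m : ℕ)
    · by_cases hmn : (m : ℕ) + 1 = n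
      · have h := hX 0 (by
          simp only [idx, rk, Finset.mem_filter, Finset.mem_Icc]
          exact ⟨by omega, Or.inr ⟨c, by omega⟩⟩) (by simp)
        have e1 : fVec n ((m : ℕ) + 1 : ℤ) = (-I) • eVec n 0 := by
          rw [eVec_zero, show ((m : ℕ) + 1 : ℤ) = n by omega]
          ext i; simp
          linear_combination (fVec n n i) * I_sq
        rw [e1]
        exact Submodule.smul_mem _ _ h
      · have := (hpair (c + 2) (by omega) (by omega)).1
        rwa [show (2 * ((c : ℤ) + 2) - 3) = ((m : ℕ) + 1 : ℤ) by omega] at this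
    · have := (hpair (c + 2) (by omega) (by omega)).2
      rwa [show (2 * ((c : ℤ) + 2) - 2) = ((m : ℕ) + 1 : ℤ) by omega] at this
  rw [pi_eq_sum_univ' a, map_sum]
  refine Submodule.sum_mem _ fun i _ => ?_
  rw [map_smul]
  refine Submodule.smul_mem _ _ ?_
  have := hsingle i
  rw [Submodule.mem_comap] at this
  convert this using 2

/-- `lowerPart` is the `ℂⁿ`-component of `A e₁`, and `q` preserves the line of `e₁`. Conversely,
removing the `p⁺`-component of such an `A` leaves an element of `k`. -/
lemma mem_q_iff (hn : 1 ≤ n) {A : G n} : A ∈ q n ↔ lowerPart n A = 0 := by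
  constructor
  · intro hA
    have h := q_mulVec n A hA
    ext i
    have := congrFun h (Sum.inr i)
    rw [e_one] at this
    simp [mulVec, dotProduct] at this
    simp only [lowerPart, LinearMap.coe_mk, AddHom.coe_mk, Pi.zero_apply]
    linear_combination this
  · intro hA
    have h1 : raising n (upperPart n A) ∈ q n :=
      LieSubalgebra.subset_lieSpan (Or.inr (raising_mem_pPlus hn _))
    have h2 : A - raising n (upperPart n A) ∈ q n := by
      refine LieSubalgebra.subset_lieSpan (Or.inl ?_)
      rw [SetLike.mem_coe, mem_k_iff]
      simp [upperPart_raising, lowerPart_raising, hA]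
    have := add_mem h2 h1
    rwa [sub_add_cancel] at this

lemma sum_Icc_neg {M : Type*} [AddCommMonoid M] (T : ℤ → M) (r : ℕ) :
    ∑ h ∈ Finset.Icc (-(r : ℤ)) r, T h =
      T 0 + ∑ j ∈ Finset.range r, (T (j + 1) + T (-(j + 1))) := by
  induction r with
  | zero => simp
  | succ r ih =>
    have : Finset.Icc (-((r + 1 : ℕ) : ℤ)) (r + 1 : ℕ) =
        insert ((r : ℤ) + 1) (insert (-((r : ℤ) + 1)) (Finset.Icc (-(r : ℤ)) r)) := by
      ext h
      simp only [Finset.mem_Icc, Finset.mem_insert]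
      omega
    rw [this, Finset.sum_insert, Finset.sum_insert, ih, Finset.sum_range_succ]
    · abel
    · simp
    · simp; omega

lemma sum_range_two_mul {M : Type*} [AddCommMonoid M] (g : ℕ → M) (s : ℕ) :
    ∑ j ∈ Finset.range s, (g (2 * j) + g (2 * j + 1)) = ∑ i ∈ Finset.range (2 * s), g i := by
  induction s with
  | zero => simp
  | succ s ih =>
    rw [Finset.sum_range_succ, ih, show 2 * (s + 1) = 2 * s + 1 + 1 by ring,
      Finset.sum_range_succ, Finset.sum_range_succ, add_assoc]

/-- The indices `h` and `-h` each contribute `-½` times the sum of two squared coordinates. For odd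
`n` the index `0` contributes `(i xₙ)² = -xₙ²`. -/
lemma sum_eVec : ∑ h ∈ (idx n).filter (fun h => |h| ≠ 1),
    lin (eVec n h) * lin (eVec n (-h)) = -(rsq : MvPolynomial (Fin n) ℂ) := by
  have hI : (MvPolynomial.C I : MvPolynomial (Fin n) ℂ) ^ 2 = -1 := by
    rw [← map_pow, I_sq]; simp
  set g : ℕ → MvPolynomial (Fin n) ℂ := fun i => lin (fVec n (i + 1)) ^ 2 with hg
  have hr : (rsq : MvPolynomial (Fin n) ℂ) = ∑ i ∈ Finset.range n, g i := by
    rw [Finset.sum_range, rsq]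
    refine Finset.sum_congr rfl fun i _ => ?_
    rw [hg]
    simp only
    rw [fVec_succ, lin_single]
  have hpair (j : ℕ) : lin (eVec n (j + 2)) * lin (eVec n (-(j + 2))) =
      MvPolynomial.C (-(1 / 2)) * (g (2 * j) + g (2 * j + 1)) := by
    rw [eVec_pos (by omega), eVec_neg (by omega), hg]
    simp only [map_add, map_sub, map_smul, MvPolynomial.smul_eq_C_mul]
    rw [show 2 * ((j : ℤ) + 2) - 3 = (2 * j : ℕ) + 1 by push_cast; ring,
      show 2 * ((j : ℤ) + 2) - 2 = (2 * j + 1 : ℕ) + 1 by push_cast; ring]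
    linear_combination (-MvPolynomial.C (-(1 / 2)) * lin (fVec n ((2 * j + 1 : ℕ) + 1)) ^ 2) * hI
  have hhalf : (MvPolynomial.C (-(1 / 2)) : MvPolynomial (Fin n) ℂ) * 2 = -1 := by
    rw [map_neg, neg_mul, half_two]
  -- `Finset.sum_range_succ'` splits off the pair `h = ±1`, which the filter excludes; `n / 2` pairs
  -- remain.
  rw [idx, Finset.filter_filter, Finset.sum_filter, sum_Icc_neg,
    show rk n = n / 2 + 1 by simp only [rk]; omega, Finset.sum_range_succ']
  have hsum : ∀ j ∈ Finset.range (n / 2),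
      ((if ((((j + 1 : ℕ) : ℤ) + 1 ≠ 0 ∨ Odd n) ∧ |(((j + 1 : ℕ) : ℤ) + 1)| ≠ 1) then
          lin (eVec n (((j + 1 : ℕ) : ℤ) + 1)) * lin (eVec n (-(((j + 1 : ℕ) : ℤ) + 1))) else 0) +
        if ((-(((j + 1 : ℕ) : ℤ) + 1) ≠ 0 ∨ Odd n) ∧ |-(((j + 1 : ℕ) : ℤ) + 1)| ≠ 1) then
          lin (eVec n (-(((j + 1 : ℕ) : ℤ) + 1))) * lin (eVec n (- -(((j + 1 : ℕ) : ℤ) + 1)))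
        else 0) = -(g (2 * j) + g (2 * j + 1)) := by
    intro j _
    rw [if_pos ⟨Or.inl (by omega), by grind⟩, if_pos ⟨Or.inl (by omega), by grind⟩, neg_neg,
      show (((j + 1 : ℕ) : ℤ) + 1) = j + 2 by push_cast; ring]
    linear_combination 2 * hpair j + (g (2 * j) + g (2 * j + 1)) * hhalf
  rw [Finset.sum_congr rfl hsum, Finset.sum_neg_distrib, sum_range_two_mul, hr]
  have hzero : lin (eVec n 0) * lin (eVec n (-0)) = -(lin (fVec n n) ^ 2) := by
    rw [neg_zero, eVec_zero, map_smul, MvPolynomial.smul_eq_C_mul]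
    linear_combination (lin (fVec n n) ^ 2) * hI
  rcases Nat.even_or_odd' n with ⟨s, hs | hs⟩
  · have hodd : ¬ Odd n := by rw [Nat.not_odd_iff_even]; exact ⟨s, by omega⟩
    rw [show 2 * (n / 2) = n by omega]
    simp [hodd]
  · have hodd : Odd n := ⟨s, hs⟩
    rw [if_pos ⟨Or.inr hodd, by simp⟩, hzero]
    have hlast : ∑ i ∈ Finset.range n, g i = ∑ i ∈ Finset.range (2 * (n / 2)), g i + g (n - 1) := by
      rw [show 2 * (n / 2) = n - 1 by omega, ← Finset.sum_range_succ, Nat.sub_add_cancel (by omega)]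
    have hgn : g (n - 1) = lin (fVec n n) ^ 2 := by
      rw [hg]
      simp only
      rw [show ((n - 1 : ℕ) : ℤ) + 1 = n by omega]
    rw [hlast, hgn]
    simp

end SO2n

end

/-! ### The isomorphism of `N(λ)` with the polynomial model. -/

noncomputable section

attribute [local instance 100] LieRing.ofAssociativeRing

namespace SO2n

open Complex Matrix PolyOp

variable {n : ℕ}

/-- Polynomials in `n` variables, as a `U(g)`-module via `rep n E₀`. -/
def Model (n : ℕ) (_E₀ : ℝ) : Type := MvPolynomial (Fin n) ℂ

namespace Model

variable {E₀ : ℝ}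

instance : AddCommGroup (Model n E₀) := inferInstanceAs (AddCommGroup (MvPolynomial (Fin n) ℂ))

instance : Module ℂ (Model n E₀) := inferInstanceAs (Module ℂ (MvPolynomial (Fin n) ℂ))

instance : Module (U n) (Model n E₀) :=
  Module.compHom (MvPolynomial (Fin n) ℂ)
    (UniversalEnvelopingAlgebra.lift ℂ (rep n E₀)).toRingHom

/-- The identity, from polynomials to the model. -/
def mk (E₀ : ℝ) : MvPolynomial (Fin n) ℂ ≃ₗ[ℂ] Model n E₀ := LinearEquiv.refl ℂ _

lemma smul_mk (u : U n) (p : MvPolynomial (Fin n) ℂ) :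
    u • mk E₀ p = mk E₀ (UniversalEnvelopingAlgebra.lift ℂ (rep n E₀) u p) := rfl

instance : IsScalarTower ℂ (U n) (Model n E₀) where
  smul_assoc c u p := by
    change UniversalEnvelopingAlgebra.lift ℂ (rep n E₀) (c • u) _ = _
    rw [map_smul]
    rfl

lemma ι_smul_mk (A : G n) (p : MvPolynomial (Fin n) ℂ) :
    UniversalEnvelopingAlgebra.ι ℂ A • mk E₀ p = mk E₀ (rep n E₀ A p) := by
  rw [smul_mk, UniversalEnvelopingAlgebra.lift_ι_apply]

lemma lowering_smul_mk (a : Fin n → ℂ) (p : MvPolynomial (Fin n) ℂ) :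
    UniversalEnvelopingAlgebra.ι ℂ (lowering n a) • mk E₀ p = mk E₀ (lin a * p) := by
  rw [ι_smul_mk, rep_apply, lowerPart_lowering, upperPart_lowering, weight₁_lowering,
    rotPart_lowering, conf_zero_left]
  simp

end Model

lemma ι_mul_ι (A B : G n) : UniversalEnvelopingAlgebra.ι ℂ A * UniversalEnvelopingAlgebra.ι ℂ B =
    UniversalEnvelopingAlgebra.ι ℂ B * UniversalEnvelopingAlgebra.ι ℂ A +
      UniversalEnvelopingAlgebra.ι ℂ ⁅A, B⁆ := by
  rw [LieHom.map_lie, Ring.lie_def]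
  abel

lemma lowering_lie (a b : Fin n → ℂ) : ⁅lowering n a, lowering n b⁆ = 0 := by
  apply ext_parts <;>
  simp [lowerPart_lie, upperPart_lie, weight₁_lie, rotPart_lie, weight₁_lowering,
    rotPart_lowering, upperPart_lowering]

lemma lowering_commute (a b : Fin n → ℂ) :
    UniversalEnvelopingAlgebra.ι ℂ (lowering n a) * UniversalEnvelopingAlgebra.ι ℂ (lowering n b) =
    UniversalEnvelopingAlgebra.ι ℂ (lowering n b) *
      UniversalEnvelopingAlgebra.ι ℂ (lowering n a) := by
  rw [ι_mul_ι, lowering_lie, map_zero, add_zero]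

open scoped IsMulCommutative in
/-- Evaluation of polynomials at a commuting family of a noncommutative algebra. -/
lemma exists_algHom_of_commute {R A ι : Type*} [CommRing R] [Ring A] [Algebra R A] (x : ι → A)
    (hx : ∀ i j, x i * x j = x j * x i) :
    ∃ τ : MvPolynomial ι R →ₐ[R] A, ∀ i, τ (MvPolynomial.X i) = x i := by
  have := Algebra.isMulCommutative_adjoin R (s := Set.range x) (by
    rintro _ ⟨i, rfl⟩ _ ⟨j, rfl⟩
    exact hx i j)
  let y : ι → Algebra.adjoin R (Set.range x) := fun i => ⟨x i, Algebra.subset_adjoin ⟨i, rfl⟩⟩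
  refine ⟨(Algebra.adjoin R (Set.range x)).val.comp (MvPolynomial.aeval y), fun i => ?_⟩
  rw [AlgHom.comp_apply, MvPolynomial.aeval_X]
  rfl

lemma exists_symbol (n : ℕ) : ∃ τ : MvPolynomial (Fin n) ℂ →ₐ[ℂ] U n,
    ∀ i, τ (MvPolynomial.X i) =
      UniversalEnvelopingAlgebra.ι ℂ (lowering n (Pi.single i 1)) :=
  exists_algHom_of_commute _ fun _ _ => lowering_commute _ _

/-- The symmetric algebra of `p⁻`, mapped into `U(g)`. -/
def symbol (n : ℕ) : MvPolynomial (Fin n) ℂ →ₐ[ℂ] U n := (exists_symbol n).choose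

lemma symbol_X (i : Fin n) : symbol n (MvPolynomial.X i) =
    UniversalEnvelopingAlgebra.ι ℂ (lowering n (Pi.single i 1)) := (exists_symbol n).choose_spec i

lemma symbol_lin (a : Fin n → ℂ) : symbol n (lin a) =
    UniversalEnvelopingAlgebra.ι ℂ (lowering n a) := by
  have : lowering n a = ∑ i, a i • lowering n (Pi.single i 1) := by
    apply ext_parts
    · simp only [map_sum, map_smul, lowerPart_lowering]
      exact pi_eq_sum_univ' a
    · simp [upperPart_lowering]
    · simp [weight₁_lowering]
    · simp [rotPart_lowering]
  rw [this, lin_apply]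
  simp [symbol_X, ← MvPolynomial.algebraMap_eq, Algebra.smul_def]

lemma q_smul_vTop (E₀ : ℝ) (A : q n) :
    UniversalEnvelopingAlgebra.ι ℂ (A : G n) • vTop n E₀ =
      (-(E₀ : ℂ) * weight₁ n A) • vTop n E₀ := by
  have h : UniversalEnvelopingAlgebra.ι ℂ (A : G n) ⊗ₜ[ℂ] (1 : ℂ) -
      (1 : U n) ⊗ₜ[ℂ] (K n E₀ A 1) ∈ LieInduced.relations (q n) (K n E₀) :=
    Submodule.subset_span ⟨A, 1, rfl⟩
  have h' := (Submodule.Quotient.eq _).2 h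
  have hK : K n E₀ A 1 = (-(E₀ : ℂ) * weight₁ n A) • (1 : ℂ) := rfl
  rw [hK, TensorProduct.tmul_smul] at h'
  have e1 : UniversalEnvelopingAlgebra.ι ℂ (A : G n) ⊗ₜ[ℂ] (1 : ℂ) =
      UniversalEnvelopingAlgebra.ι ℂ (A : G n) • ((1 : U n) ⊗ₜ[ℂ] (1 : ℂ)) := by
    rw [TensorProduct.smul_tmul', smul_eq_mul, mul_one]
  rw [e1] at h'
  exact h'

/-- For `A ∈ q` the linear form vanishes, so the constant `1` satisfies the defining relations of
the induced module. This is what makes `toModel` well defined. -/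
lemma rep_one (E₀ : ℝ) (A : G n) : rep n E₀ A 1 =
    lin (lowerPart n A) + MvPolynomial.C (-(E₀ : ℂ) * weight₁ n A) := by
  have h1 (d : Derivation ℂ (MvPolynomial (Fin n) ℂ) (MvPolynomial (Fin n) ℂ)) : d 1 = 0 :=
    d.map_one_eq_zero
  have h2 : lap (1 : MvPolynomial (Fin n) ℂ) = 0 := by
    simp [lap_apply, h1]
  simp only [rep_apply, conf, h1, h2, map_zero]
  simp
  ring

/-- Moving `A` to the right past one factor from `p⁻` produces a bracket, which is again an element
of `g` acting on a shorter product; hence the induction runs over all `A` at once. The same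
recursion holds in the model because `rep` is a Lie homomorphism. On constants, `A` differs from an
element of `p⁻` by an element of `q`, which acts by a scalar. -/
lemma ι_smul_symbol_smul_vTop (hn : 1 ≤ n) (E₀ : ℝ) (p : MvPolynomial (Fin n) ℂ) (A : G n) :
    UniversalEnvelopingAlgebra.ι ℂ A • symbol n p • vTop n E₀ =
      symbol n (rep n E₀ A p) • vTop n E₀ := by
  induction p using MvPolynomial.induction_on generalizing A with
  | C c =>
    have hA : A - lowering n (lowerPart n A) ∈ q n := by
      rw [mem_q_iff hn, map_sub, lowerPart_lowering, sub_self]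
    have h := q_smul_vTop E₀ ⟨_, hA⟩
    rw [map_sub, sub_smul, map_sub, weight₁_lowering, sub_zero] at h
    have hC (c : ℂ) : symbol n (MvPolynomial.C c) = algebraMap ℂ (U n) c :=
      (symbol n).commutes c
    have e1 : rep n E₀ A (MvPolynomial.C c) = c • rep n E₀ A 1 := by
      rw [← map_smul, MvPolynomial.smul_eq_C_mul, mul_one]
    rw [e1, rep_one, map_smul, map_add, symbol_lin, hC, hC, smul_assoc, add_smul, algebraMap_smul,
      algebraMap_smul, smul_comm, ← sub_eq_iff_eq_add'.1 h]
  | add p q hp hq => simp only [map_add, add_smul, smul_add, hp, hq]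
  | mul_X p i hp =>
    rw [mul_comm, map_mul, symbol_X, mul_smul, ← mul_smul, ι_mul_ι, add_smul, mul_smul, hp, hp,
      ← mul_smul, ← symbol_X, ← map_mul, ← add_smul, ← map_add]
    congr 2
    have h := LieHom.map_lie (rep n E₀) A (lowering n (Pi.single i 1))
    have h' := congrArg (fun T => T p) h
    simp only [Ring.lie_def, LinearMap.sub_apply, Module.End.mul_apply] at h'
    have hl (p) : rep n E₀ (lowering n (Pi.single i 1)) p = MvPolynomial.X i * p := by
      have := Model.lowering_smul_mk (E₀ := E₀) (Pi.single i 1) p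
      rw [Model.ι_smul_mk, lin_single] at this
      exact (Model.mk E₀).injective this
    rw [h', hl, hl]
    ring

/-- The universal property yields a map from `U n` to this subalgebra whose composite with the
inclusion fixes the generators, hence is the identity. -/
lemma adjoin_range_ι : Algebra.adjoin ℂ
    (Set.range (UniversalEnvelopingAlgebra.ι ℂ : G n →ₗ⁅ℂ⁆ U n)) = ⊤ := by
  set S := Algebra.adjoin ℂ (Set.range (UniversalEnvelopingAlgebra.ι ℂ : G n →ₗ⁅ℂ⁆ U n))
  let g : G n →ₗ⁅ℂ⁆ S :=
    { toFun := fun A => ⟨UniversalEnvelopingAlgebra.ι ℂ A, Algebra.subset_adjoin ⟨A, rfl⟩⟩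
      map_add' := fun A B => Subtype.ext (map_add _ A B)
      map_smul' := fun c A => Subtype.ext (map_smul _ c A)
      map_lie' := fun {A B} => Subtype.ext (LieHom.map_lie _ A B) }
  have h : S.val.comp (UniversalEnvelopingAlgebra.lift ℂ g) = AlgHom.id ℂ (U n) := by
    apply UniversalEnvelopingAlgebra.hom_ext
    ext A
    change ((UniversalEnvelopingAlgebra.lift ℂ g (UniversalEnvelopingAlgebra.ι ℂ A) : S) : U n) = _
    rw [UniversalEnvelopingAlgebra.lift_ι_apply]
    rfl
  rw [eq_top_iff]
  intro u _
  have := congrArg (fun F => F u) h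
  simp only [AlgHom.id_apply] at this
  rw [← this]
  exact (UniversalEnvelopingAlgebra.lift ℂ g u).2

lemma smul_symbol_smul_vTop (hn : 1 ≤ n) (E₀ : ℝ) (u : U n) (p : MvPolynomial (Fin n) ℂ) :
    u • symbol n p • vTop n E₀ =
      symbol n (UniversalEnvelopingAlgebra.lift ℂ (rep n E₀) u p) • vTop n E₀ := by
  have hu : u ∈ Algebra.adjoin ℂ
    (Set.range (UniversalEnvelopingAlgebra.ι ℂ : G n →ₗ⁅ℂ⁆ U n)) := by
    rw [adjoin_range_ι]; trivial
  induction hu using Algebra.adjoin_induction generalizing p with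
  | mem u hu =>
    obtain ⟨A, rfl⟩ := hu
    rw [ι_smul_symbol_smul_vTop hn, UniversalEnvelopingAlgebra.lift_ι_apply]
  | algebraMap c =>
    rw [AlgHom.commutes, algebraMap_smul, Module.algebraMap_end_apply, map_smul, smul_assoc]
  | add u v _ _ hu hv => rw [add_smul, hu, hv, map_add, LinearMap.add_apply, map_add, add_smul]
  | mul u v _ _ hu hv => rw [mul_smul, hv, hu, map_mul, Module.End.mul_apply]

/-- The map from the model to `N(λ)`. -/
def fromModel (hn : 1 ≤ n) (E₀ : ℝ) : Model n E₀ →ₗ[U n] N n E₀ where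
  toFun p := symbol n ((Model.mk E₀).symm p) • vTop n E₀
  map_add' p q := by rw [map_add, map_add, add_smul]
  map_smul' u p := (smul_symbol_smul_vTop hn E₀ u ((Model.mk E₀).symm p)).symm

/-- The map from `N(λ)` to the model. -/
def toModel (hn : 1 ≤ n) (E₀ : ℝ) : N n E₀ →ₗ[U n] Model n E₀ :=
  Submodule.liftQ _ ((LinearMap.toSpanSingleton (U n) (Model n E₀) (Model.mk E₀ 1)).comp
    (TensorProduct.AlgebraTensorModule.rid ℂ (U n) (U n)).toLinearMap) (by
      refine Submodule.span_le.2 ?_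
      rintro _ ⟨A, c, rfl⟩
      rw [SetLike.mem_coe, LinearMap.mem_ker, map_sub, sub_eq_zero]
      have hK : K n E₀ A c = (-(E₀ : ℂ) * weight₁ n A) * c := rfl
      have hC (w : ℂ) : Model.mk E₀ (MvPolynomial.C w : MvPolynomial (Fin n) ℂ) =
          w • Model.mk E₀ 1 := by
        rw [← map_smul, MvPolynomial.smul_eq_C_mul, mul_one]
      simp only [LinearMap.comp_apply, LinearEquiv.coe_coe,
        TensorProduct.AlgebraTensorModule.rid_tmul, LinearMap.toSpanSingleton_apply, hK]
      rw [smul_assoc, smul_assoc, one_smul, Model.ι_smul_mk, rep_one, (mem_q_iff hn).1 A.2,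
        map_zero, zero_add, hC, smul_smul, mul_comm])

lemma toModel_vTop (hn : 1 ≤ n) (E₀ : ℝ) : toModel hn E₀ (vTop n E₀) = Model.mk E₀ 1 := by
  change (LinearMap.toSpanSingleton (U n) (Model n E₀) (Model.mk E₀ 1))
    (TensorProduct.AlgebraTensorModule.rid ℂ (U n) (U n) (1 ⊗ₜ[ℂ] 1)) = _
  simp

lemma symbol_smul_mk (E₀ : ℝ) (p q : MvPolynomial (Fin n) ℂ) :
    symbol n p • Model.mk E₀ q = Model.mk E₀ (p * q) := by
  induction p using MvPolynomial.induction_on generalizing q with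
  | C c =>
    have hC : symbol n (MvPolynomial.C c) = algebraMap ℂ (U n) c := (symbol n).commutes c
    rw [hC, algebraMap_smul, ← map_smul, MvPolynomial.smul_eq_C_mul]
  | add p p' hp hp' => rw [map_add, add_smul, hp, hp', add_mul, map_add]
  | mul_X p i hp =>
    rw [map_mul, mul_smul, symbol_X, Model.lowering_smul_mk, lin_single, hp, mul_assoc]

lemma span_vTop (n : ℕ) (E₀ : ℝ) : Submodule.span (U n) {vTop n E₀} = ⊤ := by
  rw [eq_top_iff]
  intro x _
  obtain ⟨t, rfl⟩ := Submodule.Quotient.mk_surjective _ x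
  induction t using TensorProduct.induction_on with
  | zero => simp
  | add x y hx hy => exact add_mem (hx trivial) (hy trivial)
  | tmul u c =>
    refine Submodule.mem_span_singleton.2 ⟨c • u, ?_⟩
    change Submodule.Quotient.mk ((c • u) • ((1 : U n) ⊗ₜ[ℂ] (1 : ℂ))) = _
    rw [TensorProduct.smul_tmul', smul_eq_mul, mul_one, TensorProduct.smul_tmul, smul_eq_mul,
      mul_one]

/-- `N(λ)` is isomorphic to the polynomial model. -/
def equivModel (hn : 1 ≤ n) (E₀ : ℝ) : N n E₀ ≃ₗ[U n] Model n E₀ :=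
  LinearEquiv.ofLinearMap (toModel hn E₀) (fromModel hn E₀)
    (LinearMap.ext fun p => by
      change toModel hn E₀ (symbol n ((Model.mk E₀).symm p) • vTop n E₀) = p
      rw [map_smul, toModel_vTop, symbol_smul_mk, mul_one]
      rfl)
    (by
      -- Both maps are `U(g)`-linear, so comparison on the cyclic vector suffices.
      refine LinearMap.ext_on (s := {vTop n E₀}) (span_vTop n E₀) ?_
      rintro _ rfl
      rw [LinearMap.comp_apply, toModel_vTop]
      change symbol n 1 • vTop n E₀ = _
      rw [map_one, one_smul]
      rfl)

lemma equivModel_vTop (hn : 1 ≤ n) (E₀ : ℝ) :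
    equivModel hn E₀ (vTop n E₀) = Model.mk E₀ 1 := toModel_vTop hn E₀

lemma Z_eq_symbol (hn : 1 ≤ n) : Z n = symbol n (-rsq) := by
  rw [← sum_eVec, map_sum, Z]
  refine Finset.sum_congr rfl fun h hh => ?_
  have h1 : |h| ≠ 1 := (Finset.mem_filter.1 hh).2
  rw [X_neg_one hn h1, X_neg_one hn (by rwa [abs_neg]), map_mul, symbol_lin, symbol_lin]

/-- The isotropic linear form `x₁ + i x₂`. -/
def zlin (n : ℕ) : MvPolynomial (Fin n) ℂ := lin (eVec n 2)

lemma equivModel_v (hn : 1 ≤ n) (E₀ : ℝ) (l k : ℕ) :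
    equivModel hn E₀ (v n E₀ l k) = Model.mk E₀ (zlin n ^ l * (-rsq) ^ k) := by
  rw [v, map_smul, equivModel_vTop, Z_eq_symbol hn, X_neg_one hn (by norm_num), ← symbol_lin,
    ← zlin, ← map_pow (symbol n), ← map_pow (symbol n), ← map_mul (symbol n), symbol_smul_mk,
    mul_one]

end SO2n

end

/-! ### Submodules of the model as stable spaces of polynomials. -/

noncomputable section

attribute [local instance 100] LieRing.ofAssociativeRing

namespace SO2n

open Complex Matrix PolyOp

variable {n : ℕ} {E₀ : ℝ}

/-- The element of `k` with given components in `so(2)` and `so(n)`. -/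
def compactElem (t : ℂ) (B : Matrix (Fin n) (Fin n) ℂ) (hB : Bᵀ = -B) : G n :=
  ⟨Matrix.fromBlocks !![0, -I * t; I * t, 0] 0 0 B, by
    rw [mem_so']
    have h (i j) : B j i = - B i j := congrFun (congrFun hB i) j
    ext (i | i) (j | j)
    · fin_cases i <;> fin_cases j <;>
        simp [eta, LieAlgebra.Orthogonal.indefiniteDiagonal, Matrix.mul_diagonal,
          Matrix.diagonal_mul]
    all_goals simp [eta, LieAlgebra.Orthogonal.indefiniteDiagonal, Matrix.mul_diagonal,
      Matrix.diagonal_mul]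
    rw [h i j, neg_neg]⟩

section compactElem

variable (t : ℂ) (B : Matrix (Fin n) (Fin n) ℂ) (hB : Bᵀ = -B)

lemma lowerPart_compactElem : lowerPart n (compactElem t B hB) = 0 := by
  ext i; simp [lowerPart, compactElem]

lemma upperPart_compactElem : upperPart n (compactElem t B hB) = 0 := by
  ext i; simp [upperPart, compactElem]

lemma weight₁_compactElem : weight₁ n (compactElem t B hB) = t := by
  simp only [weight₁_apply, compactElem]
  simp
  linear_combination (-t) * I_sq

lemma rotPart_compactElem : rotPart n (compactElem t B hB) = B := by
  ext i j; rfl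

lemma compactElem_mem : compactElem t B hB ∈ k n :=
  mem_k_iff.2 ⟨lowerPart_compactElem t B hB, upperPart_compactElem t B hB⟩

lemma rep_compactElem (p : MvPolynomial (Fin n) ℂ) : rep n E₀ (compactElem t B hB) p =
    vf B p - MvPolynomial.C t * (euler p + MvPolynomial.C (E₀ : ℂ) * p) := by
  rw [rep_apply, lowerPart_compactElem, upperPart_compactElem, weight₁_compactElem,
    rotPart_compactElem, conf_zero_left, map_zero]
  ring

end compactElem

/-- Stability of a space of polynomials under the Euler operator and rotations. -/
structure KStable (S : Submodule ℂ (MvPolynomial (Fin n) ℂ)) : Prop where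
  euler_mem : ∀ p ∈ S, euler p ∈ S
  vf_mem : ∀ B : Matrix (Fin n) (Fin n) ℂ, Bᵀ = -B → ∀ p ∈ S, vf B p ∈ S

/-- Stability of a space of polynomials under the whole Lie algebra. -/
structure GStable (E₀ : ℝ) (S : Submodule ℂ (MvPolynomial (Fin n) ℂ)) : Prop
    extends KStable S where
  lin_mem : ∀ a, ∀ p ∈ S, lin a * p ∈ S
  conf_mem : ∀ a, ∀ p ∈ S, conf E₀ a p ∈ S

lemma KStable.rep_mem {S : Submodule ℂ (MvPolynomial (Fin n) ℂ)} (hS : KStable S) {A : G n}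
    (hA : A ∈ k n) {p : MvPolynomial (Fin n) ℂ} (hp : p ∈ S) : rep n E₀ A p ∈ S := by
  rw [mem_k_iff] at hA
  rw [rep_apply, hA.1, hA.2, conf_zero_left, map_zero, zero_mul, zero_add, zero_sub,
    ← MvPolynomial.smul_eq_C_mul, ← MvPolynomial.smul_eq_C_mul]
  exact add_mem (neg_mem (S.smul_mem _ (add_mem (hS.euler_mem _ hp) (S.smul_mem _ hp))))
    (hS.vf_mem _ (rotPart_transpose A) _ hp)

lemma GStable.rep_mem {S : Submodule ℂ (MvPolynomial (Fin n) ℂ)} (hS : GStable E₀ S) (A : G n)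
    {p : MvPolynomial (Fin n) ℂ} (hp : p ∈ S) : rep n E₀ A p ∈ S := by
  rw [rep_apply, ← MvPolynomial.smul_eq_C_mul, ← MvPolynomial.smul_eq_C_mul]
  exact add_mem (sub_mem (add_mem (hS.lin_mem _ _ hp) (hS.conf_mem _ _ hp))
    (S.smul_mem _ (add_mem (hS.euler_mem _ hp) (S.smul_mem _ hp))))
    (hS.vf_mem _ (rotPart_transpose A) _ hp)

/-- A `K`-stable space of polynomials as a `U(k)`-submodule of the model. -/
def KStable.toSubmodule {S : Submodule ℂ (MvPolynomial (Fin n) ℂ)} (hS : KStable S) (E₀ : ℝ) :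
    Submodule (Uk n) (Model n E₀) where
  carrier := {p | (Model.mk E₀).symm p ∈ S}
  add_mem' := fun {p q} hp hq => S.add_mem hp hq
  zero_mem' := S.zero_mem
  smul_mem' := by
    rintro ⟨u, hu⟩ p hp
    change UniversalEnvelopingAlgebra.lift ℂ (rep n E₀) u ((Model.mk E₀).symm p) ∈ S
    replace hp : (Model.mk E₀).symm p ∈ S := hp
    generalize (Model.mk E₀).symm p = q at hp
    rw [Uk] at hu
    induction hu using Algebra.adjoin_induction generalizing q with
    | mem u hu =>
      obtain ⟨A, hA, rfl⟩ := hu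
      rw [UniversalEnvelopingAlgebra.lift_ι_apply]
      exact hS.rep_mem hA hp
    | algebraMap c =>
      rw [AlgHom.commutes, Module.algebraMap_end_apply]
      exact S.smul_mem _ hp
    | add u v _ _ hu hv =>
      rw [map_add, LinearMap.add_apply]
      exact add_mem (hu _ hp) (hv _ hp)
    | mul u v _ _ hu hv =>
      rw [map_mul, Module.End.mul_apply]
      exact hu _ (hv _ hp)

/-- A `G`-stable space of polynomials as a `U(g)`-submodule of the model. -/
def GStable.toSubmodule {S : Submodule ℂ (MvPolynomial (Fin n) ℂ)} (hS : GStable E₀ S) :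
    Submodule (U n) (Model n E₀) where
  carrier := {p | (Model.mk E₀).symm p ∈ S}
  add_mem' := fun {p q} hp hq => S.add_mem hp hq
  zero_mem' := S.zero_mem
  smul_mem' := by
    rintro u p hp
    change UniversalEnvelopingAlgebra.lift ℂ (rep n E₀) u ((Model.mk E₀).symm p) ∈ S
    replace hp : (Model.mk E₀).symm p ∈ S := hp
    generalize (Model.mk E₀).symm p = q at hp
    have hu : u ∈ Algebra.adjoin ℂ
        (Set.range (UniversalEnvelopingAlgebra.ι ℂ : G n →ₗ⁅ℂ⁆ U n)) := by
      rw [adjoin_range_ι]; trivial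
    induction hu using Algebra.adjoin_induction generalizing q with
    | mem u hu =>
      obtain ⟨A, rfl⟩ := hu
      rw [UniversalEnvelopingAlgebra.lift_ι_apply]
      exact hS.rep_mem A hp
    | algebraMap c =>
      rw [AlgHom.commutes, Module.algebraMap_end_apply]
      exact S.smul_mem _ hp
    | add u v _ _ hu hv =>
      rw [map_add, LinearMap.add_apply]
      exact add_mem (hu _ hp) (hv _ hp)
    | mul u v _ _ hu hv =>
      rw [map_mul, Module.End.mul_apply]
      exact hu _ (hv _ hp)

lemma KStable.mk_mem {S : Submodule ℂ (MvPolynomial (Fin n) ℂ)} (hS : KStable S)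
    {p : MvPolynomial (Fin n) ℂ} : Model.mk E₀ p ∈ hS.toSubmodule E₀ ↔ p ∈ S := Iff.rfl

lemma GStable.mk_mem {S : Submodule ℂ (MvPolynomial (Fin n) ℂ)} (hS : GStable E₀ S)
    {p : MvPolynomial (Fin n) ℂ} : Model.mk E₀ p ∈ hS.toSubmodule ↔ p ∈ S := Iff.rfl

/-- The polynomials in a `U(k)`-submodule of the model. -/
def polysK (T : Submodule (Uk n) (Model n E₀)) : Submodule ℂ (MvPolynomial (Fin n) ℂ) where
  carrier := {p | Model.mk E₀ p ∈ T}
  add_mem' := fun {p q} hp hq => T.add_mem hp hq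
  zero_mem' := T.zero_mem
  smul_mem' := fun c p hp => by
    change Model.mk E₀ (c • p) ∈ T
    have := T.smul_mem (algebraMap ℂ (Uk n) c) hp
    have e : algebraMap ℂ (Uk n) c • Model.mk E₀ p = Model.mk E₀ (c • p) := by
      rw [map_smul]
      exact algebraMap_smul (U n) c (Model.mk E₀ p)
    rw [← e]
    exact this

lemma mem_polysK {T : Submodule (Uk n) (Model n E₀)} {p : MvPolynomial (Fin n) ℂ} :
    p ∈ polysK T ↔ Model.mk E₀ p ∈ T := Iff.rfl

lemma rep_mem_polysK {T : Submodule (Uk n) (Model n E₀)} {p : MvPolynomial (Fin n) ℂ}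
    (hp : p ∈ polysK T) {A : G n} (hA : A ∈ k n) : rep n E₀ A p ∈ polysK T := by
  rw [mem_polysK, ← Model.ι_smul_mk]
  exact T.smul_mem (⟨_, Algebra.subset_adjoin ⟨A, hA, rfl⟩⟩ : Uk n) hp

lemma kStable_polysK (T : Submodule (Uk n) (Model n E₀)) : KStable (polysK T) where
  euler_mem p hp := by
    have h0 : (0 : Matrix (Fin n) (Fin n) ℂ)ᵀ = -0 := by simp
    -- The element of weight `-1` without rotation acts as `E + E₀`; subtracting `E₀ p` isolates
    -- `E`.
    have h := rep_mem_polysK hp (compactElem_mem (-1) 0 h0)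
    rw [rep_compactElem] at h
    have h2 := sub_mem h ((polysK T).smul_mem (E₀ : ℂ) hp)
    rw [MvPolynomial.smul_eq_C_mul] at h2
    convert h2 using 1
    simp
  vf_mem B hB p hp := by
    have h := rep_mem_polysK hp (compactElem_mem 0 B hB)
    rw [rep_compactElem] at h
    simpa using h

/-- The polynomials in a `U(g)`-submodule of the model. -/
def polys (T : Submodule (U n) (Model n E₀)) : Submodule ℂ (MvPolynomial (Fin n) ℂ) :=
  polysK (T.restrictScalars (Uk n))

lemma mem_polys {T : Submodule (U n) (Model n E₀)} {p : MvPolynomial (Fin n) ℂ} :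
    p ∈ polys T ↔ Model.mk E₀ p ∈ T := Iff.rfl

/-- Multiplication by a linear form and `conf E₀ a` are themselves actions of elements of `p⁻` and
`p⁺`. -/
lemma gStable_polys (T : Submodule (U n) (Model n E₀)) : GStable E₀ (polys T) where
  toKStable := kStable_polysK _
  lin_mem a p hp := by
    rw [mem_polys, ← Model.lowering_smul_mk]
    exact T.smul_mem _ hp
  conf_mem a p hp := by
    have h : UniversalEnvelopingAlgebra.ι ℂ (raising n a) • Model.mk E₀ p ∈ T := T.smul_mem _ hp
    rw [Model.ι_smul_mk, rep_apply, upperPart_raising, lowerPart_raising, weight₁_raising,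
      rotPart_raising] at h
    rw [mem_polys]
    convert h using 2
    simp

end SO2n

end

/-! ### Homogeneous polynomials, powers of `r²`, and singular vectors. -/

noncomputable section

namespace PolyOp

open MvPolynomial Matrix

set_option linter.unusedSectionVars false

variable {σ : Type*} [Fintype σ] [DecidableEq σ]

lemma C_two : (C 2 : MvPolynomial σ ℂ) = 2 := rfl

/-- `E` is diagonal on monomials. Homogeneity can thus be tested by an eigenvalue equation, and
negative eigenvalues do not occur. -/
lemma coeff_euler (m : σ →₀ ℕ) (p : MvPolynomial σ ℂ) :
    coeff m (euler p) = (m.degree : ℂ) * coeff m p := by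
  induction p using MvPolynomial.induction_on' with
  | monomial m' c =>
    have h : euler (monomial m' c) = ((m'.degree : ℂ)) • monomial m' c := by
      have := (isHomogeneous_monomial (σ := σ) (n := m'.degree) c rfl).sum_X_mul_pderiv
      rw [euler_apply, this, Nat.cast_smul_eq_nsmul]
    rw [h, coeff_smul, coeff_monomial]
    split_ifs with h
    · rw [h]; rfl
    · simp
  | add p q hp hq => rw [map_add, coeff_add, hp, hq, coeff_add, mul_add]

lemma euler_of_isHomogeneous {p : MvPolynomial σ ℂ} {d : ℕ} (hp : p.IsHomogeneous d) :
    euler p = C (d : ℂ) * p := by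
  rw [euler_apply, hp.sum_X_mul_pderiv, ← Nat.cast_smul_eq_nsmul ℂ, smul_eq_C_mul]

lemma isHomogeneous_of_euler {p : MvPolynomial σ ℂ} {d : ℕ} (hp : euler p = C (d : ℂ) * p) :
    p.IsHomogeneous d := by
  intro m hm
  have h := congrArg (coeff m) hp
  rw [coeff_euler, coeff_C_mul] at h
  have h1 := mul_right_cancel₀ hm h
  have h2 : m.degree = d := by exact_mod_cast h1
  rw [← h2, Finsupp.degree_eq_weight_one]
  rfl

lemma eq_zero_of_euler_neg {p : MvPolynomial σ ℂ} (hp : euler p = - p) : p = 0 := by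
  ext m
  have h := congrArg (coeff m) hp
  rw [coeff_euler, coeff_neg] at h
  rw [coeff_zero]
  have h1 : ((m.degree : ℂ) + 1) * coeff m p = 0 := by linear_combination h
  exact (mul_eq_zero.1 h1).resolve_left (Nat.cast_add_one_ne_zero _)

lemma euler_rsq : euler (rsq : MvPolynomial σ ℂ) = 2 * rsq := by
  simp only [rsq, map_sum, Finset.mul_sum]
  refine Finset.sum_congr rfl fun i _ => ?_
  simp [pow_two]; ring

lemma isHomogeneous_rsq : (rsq : MvPolynomial σ ℂ).IsHomogeneous 2 :=
  isHomogeneous_of_euler (by rw [euler_rsq]; rfl)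

lemma euler_rsq_mul (p : MvPolynomial σ ℂ) : euler (rsq * p) = rsq * (euler p + 2 * p) := by
  simp [euler_rsq]; ring

lemma dir_rsq (a : σ → ℂ) : dir a rsq = 2 * lin a := by
  simp only [rsq, map_sum, Finset.mul_sum, lin_apply]
  refine Finset.sum_congr rfl fun i _ => ?_
  simp [pow_two]; ring

lemma dir_rsq_mul (a : σ → ℂ) (p : MvPolynomial σ ℂ) :
    dir a (rsq * p) = 2 * lin a * p + rsq * dir a p := by
  simp [dir_rsq]; ring

lemma lap_rsq_mul (p : MvPolynomial σ ℂ) :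
    lap (rsq * p) = rsq * lap p + 4 * euler p + 2 * (Fintype.card σ : MvPolynomial σ ℂ) * p := by
  have h (i : σ) : lap (X i ^ 2 * p) = X i ^ 2 * lap p + 4 * (X i * pderiv i p) + 2 * p := by
    rw [pow_two, mul_assoc, lap_X_mul, lap_X_mul]
    simp
    ring
  rw [rsq, Finset.sum_mul, map_sum]
  simp only [h, Finset.sum_add_distrib, ← Finset.sum_mul, ← Finset.mul_sum, ← euler_apply]
  rw [Finset.sum_const, Finset.card_univ, nsmul_eq_mul]
  ring

lemma vf_rsq {B : Matrix σ σ ℂ} (hB : Bᵀ = -B) : vf B rsq = 0 := by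
  have h1 : vf B rsq = 2 * ∑ i, ∑ j, C (B j i) * (X i * X j) := by
    simp only [rsq, map_sum, Finset.mul_sum]
    refine Finset.sum_congr rfl fun i _ => ?_
    simp only [pow_two, Derivation.leibniz, vf_X, smul_eq_mul, lin_apply, Matrix.col_apply,
      ← two_mul, Finset.mul_sum]
    exact Finset.sum_congr rfl fun j _ => by ring
  have h2 : ∑ i, ∑ j, (C (B j i) * (X i * X j) : MvPolynomial σ ℂ) =
      - ∑ i, ∑ j, C (B j i) * (X i * X j) := by
    conv_lhs => rw [Finset.sum_comm]
    rw [← Finset.sum_neg_distrib]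
    refine Finset.sum_congr rfl fun j _ => ?_
    rw [← Finset.sum_neg_distrib]
    refine Finset.sum_congr rfl fun i _ => ?_
    have h : B j i = - B i j := congrFun (congrFun hB i) j
    rw [h, C_neg]
    ring
  rw [h1, self_eq_neg.1 h2, mul_zero]

lemma vf_rsq_pow_mul {B : Matrix σ σ ℂ} (hB : Bᵀ = -B) (m : ℕ) (p : MvPolynomial σ ℂ) :
    vf B (rsq ^ m * p) = rsq ^ m * vf B p := by
  simp [vf_rsq hB]

lemma conf_rsq_mul (s : ℂ) (a : σ → ℂ) (p : MvPolynomial σ ℂ) :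
    conf s a (rsq * p) = rsq * conf s a p - 2 * rsq * dir a p +
      C (Fintype.card σ - 2 * s - 2) * (lin a * p) := by
  have h2 (q : MvPolynomial σ ℂ) : euler (2 * q) = 2 * euler q := deriv_C_mul euler 2 q
  have h3 : (C (Fintype.card σ - 2 * s - 2) : MvPolynomial σ ℂ) =
      (Fintype.card σ : MvPolynomial σ ℂ) - 2 * C s - 2 := by simp [C_two]
  simp only [conf, dir_rsq_mul, map_add, euler_rsq_mul, lap_rsq_mul, mul_assoc, h2, euler_lin_mul,
    h3]
  linear_combination (lin a * (2 * euler p + (Fintype.card σ : MvPolynomial σ ℂ) * p)) *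
    (half_two (σ := σ))

lemma dir_rsq_pow_mul (a : σ → ℂ) (m : ℕ) (p : MvPolynomial σ ℂ) :
    dir a (rsq ^ (m + 1) * p) = rsq ^ (m + 1) * dir a p +
      2 * ((m : MvPolynomial σ ℂ) + 1) * (rsq ^ m * lin a * p) := by
  simp [dir_rsq, Derivation.leibniz_pow]
  ring

/-- The scalar in the last term is the source of the reduction points: it vanishes exactly for `s =
n/2 - (m + 1)`, where `n` is the number of variables. -/
lemma conf_rsq_pow_mul (s : ℂ) (a : σ → ℂ) (m : ℕ) (p : MvPolynomial σ ℂ) :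
    conf s a (rsq ^ (m + 1) * p) =
      rsq ^ (m + 1) * (conf s a p - 2 * ((m : MvPolynomial σ ℂ) + 1) * dir a p) +
      C ((m + 1) * (Fintype.card σ - 2 * s - 2 * (m + 1))) * (rsq ^ m * lin a * p) := by
  induction m with
  | zero =>
    simp only [zero_add, pow_one, conf_rsq_mul, pow_zero]
    simp
    ring
  | succ m ih =>
    rw [pow_succ' _ (m + 1), mul_assoc, conf_rsq_mul, ih, dir_rsq_pow_mul]
    simp [C_two]
    ring

/-- This contraction recovers `p` from `r²Δp` and the `conf`-images, provided `d (d - 1 + s) ≠ 0`.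
-/
lemma sum_X_mul_conf (s : ℂ) (p : MvPolynomial σ ℂ) {d : ℂ} (hp : euler p = C d * p) :
    ∑ i, X i * conf s (Pi.single i 1) p = C (1 / 2) * (rsq * lap p) - C (d * (d - 1 + s)) * p := by
  have h (i : σ) : X i * conf s (Pi.single i 1) p =
      C (1 / 2) * (X i ^ 2 * lap p) - C (d - 1 + s) * (X i * pderiv i p) := by
    rw [conf, euler_dir, hp, deriv_C_mul, lin_single, dir_single]
    simp
    ring
  simp only [h, Finset.sum_sub_distrib, ← Finset.mul_sum, ← euler_apply, hp, ← Finset.sum_mul]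
  simp [rsq]
  ring

lemma euler_lap_of_euler {p : MvPolynomial σ ℂ} {d : ℂ} (hp : euler p = C d * p) :
    euler (lap p) = C (d - 2) * lap p := by
  rw [euler_lap, hp, lap_C_mul, map_sub, sub_mul]
  rfl

lemma euler_dir_of_euler {p : MvPolynomial σ ℂ} {d : ℂ} (hp : euler p = C d * p) (a : σ → ℂ) :
    euler (dir a p) = C (d - 1) * dir a p := by
  rw [euler_dir, hp, deriv_C_mul, map_sub, sub_mul]
  simp

lemma euler_conf_of_euler {p : MvPolynomial σ ℂ} {d : ℂ} (hp : euler p = C d * p) (s : ℂ)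
    (a : σ → ℂ) : euler (conf s a p) = C (d - 1) * conf s a p := by
  rw [euler_conf, hp, conf_C_mul, map_sub, sub_mul]
  simp

lemma conf_of_euler {p : MvPolynomial σ ℂ} {d : ℂ} (hp : euler p = C d * p) (s : ℂ)
    (a : σ → ℂ) : conf s a p = C (1 / 2) * (lin a * lap p) - C (d - 1 + s) * dir a p := by
  rw [conf, euler_dir_of_euler hp]
  simp
  ring

lemma sum_pderiv_X_mul (p : MvPolynomial σ ℂ) :
    ∑ i, pderiv i (X i * p) = (Fintype.card σ : MvPolynomial σ ℂ) * p + euler p := by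
  simp [euler_apply, Finset.sum_add_distrib]
  ring

/-- The companion contraction recovers `Δp` from the `conf`-images, except in the critical degree `d
= n - 2s`, where `n` is the number of variables. -/
lemma sum_pderiv_conf (s : ℂ) (p : MvPolynomial σ ℂ) {d : ℂ} (hp : euler p = C d * p) :
    ∑ i, pderiv i (conf s (Pi.single i 1) p) = C ((Fintype.card σ - d - 2 * s) / 2) * lap p := by
  have h (i : σ) : pderiv i (conf s (Pi.single i 1) p) =
      C (1 / 2) * pderiv i (X i * lap p) - C (d - 1 + s) * pderiv i (pderiv i p) := by
    rw [conf_of_euler hp, map_sub, deriv_C_mul, deriv_C_mul, lin_single, dir_single]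
  simp only [h, Finset.sum_sub_distrib, ← Finset.mul_sum, ← lap_apply, sum_pderiv_X_mul,
    euler_lap_of_euler hp]
  have h3 : (C ((Fintype.card σ - d - 2 * s) / 2) : MvPolynomial σ ℂ) =
      C (1 / 2) * ((Fintype.card σ : MvPolynomial σ ℂ) - C d - 2 * C s) := by
    rw [div_eq_mul_one_div, mul_comm, C_mul]; simp [C_two]
  rw [h3]
  simp only [map_add, map_sub, map_one, map_ofNat]
  linear_combination ((C s + C d - 1) * lap p) * (half_two (σ := σ))

/-- A homogeneous rotation invariant polynomial is a multiple of a power of `rsq`. -/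
lemma eq_rsq_pow_of_invariant (hσ : 2 ≤ Fintype.card σ) (d : ℕ) :
    ∀ p : MvPolynomial σ ℂ, p.IsHomogeneous d →
    (∀ a b, lin b * dir a p = lin a * dir b p) → p ≠ 0 →
    ∃ (m : ℕ) (c : ℂ), d = 2 * m ∧ p = C c * rsq ^ m := by
  induction d using Nat.strong_induction_on with
  | _ d ih =>
    intro p hp hinv hp0
    have he := euler_of_isHomogeneous hp
    rcases Nat.eq_zero_or_pos d with rfl | hd
    · refine ⟨0, coeff 0 p, rfl, ?_⟩
      rw [pow_zero, mul_one]
      exact totalDegree_eq_zero_iff_eq_C.1 (hp.totalDegree hp0)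
    -- Apply `∂ᵢ` to the invariance relation `xⱼ ∂ᵢ p = xᵢ ∂ⱼ p` and sum over `i`. Multiplying the
    -- result by `xⱼ` and summing then gives `r²Δp = (n + d - 2) d p`, so `p` is divisible by `r²`
    -- and the induction continues with `Δp`.
    · have h1 (j : σ) : X j * lap p = C ((Fintype.card σ : ℂ) + d - 2) * pderiv j p := by
        have hs : ∑ i, pderiv i (X j * pderiv i p) = ∑ i, pderiv i (X i * pderiv j p) := by
          refine Finset.sum_congr rfl fun i _ => ?_
          have := hinv (Pi.single i 1) (Pi.single j 1)
          simp only [lin_single, dir_single] at this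
          rw [this]
        have h2 (i : σ) : pderiv i (X j * pderiv i p) =
            X j * pderiv i (pderiv i p) + if i = j then pderiv j p else 0 := by
          split_ifs with h
          · subst h; simp
          · simp [pderiv_X_of_ne (Ne.symm h)]
        have h3 := euler_dir_of_euler he (Pi.single j 1)
        rw [dir_single] at h3
        rw [sum_pderiv_X_mul, h3, Finset.sum_congr rfl fun i _ => h2 i, Finset.sum_add_distrib,
          ← Finset.mul_sum, ← lap_apply, Finset.sum_ite_eq'] at hs
        simp at hs
        simp [C_two]
        linear_combination hs
      have h2 : rsq * lap p = C (((Fintype.card σ : ℂ) + d - 2) * d) * p := by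
        rw [rsq, Finset.sum_mul]
        simp only [pow_two, mul_assoc, h1]
        simp only [mul_left_comm (X _), ← Finset.mul_sum, ← euler_apply, he]
        rw [← mul_assoc, ← C_mul]
      have hc : ((Fintype.card σ : ℂ) + d - 2) * d ≠ 0 := by
        have h3 : ((Fintype.card σ : ℂ) + d - 2) * d =
            (((Fintype.card σ + d - 2) * d : ℕ) : ℂ) := by
          push_cast [Nat.cast_sub (show 2 ≤ Fintype.card σ + d by omega)]; ring
        rw [h3, Nat.cast_ne_zero]
        exact Nat.mul_ne_zero (by omega) (by omega)
      have hp' : p = C ((((Fintype.card σ : ℂ) + d - 2) * d)⁻¹) * (rsq * lap p) := by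
        rw [h2, ← mul_assoc, ← C_mul, inv_mul_cancel₀ hc, C_1, one_mul]
      have hl0 : lap p ≠ 0 := by
        intro h
        rw [h] at hp'
        simp at hp'
        exact hp0 hp'
      have hel := euler_lap_of_euler he
      -- In degree `1` the nonzero polynomial `Δp` would have Euler eigenvalue `-1`.
      have hd2 : 2 ≤ d := by
        by_contra h
        have hd1 : d = 1 := by omega
        subst hd1
        refine hl0 (eq_zero_of_euler_neg ?_)
        rw [hel, Nat.cast_one, show (1 - 2 : ℂ) = -1 by norm_num]
        simp
      have hinv' : ∀ a b, lin b * dir a (lap p) = lin a * dir b (lap p) := by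
        intro a b
        have hB : (vecMulVec b a - vecMulVec a b)ᵀ = -(vecMulVec b a - vecMulVec a b) := by
          ext i j; simp [vecMulVec_apply]; ring
        have h3 := vf_lap hB p
        have h4 : vf (vecMulVec b a - vecMulVec a b) p = 0 := by
          rw [vf_sub, vf_vecMulVec, vf_vecMulVec, hinv, sub_self]
        rw [h4, map_zero, vf_sub, vf_vecMulVec, vf_vecMulVec] at h3
        exact sub_eq_zero.1 h3
      obtain ⟨m, c, hm, hmc⟩ := ih (d - 2) (by omega) (lap p) (isHomogeneous_of_euler (by
        rw [hel, Nat.cast_sub hd2]; rfl)) hinv' hl0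
      refine ⟨m + 1, (((Fintype.card σ : ℂ) + d - 2) * d)⁻¹ * c, by omega, ?_⟩
      rw [hmc] at hp'
      rw [hp', C_mul, pow_succ]
      ring

/-- A homogeneous polynomial of positive degree annihilated by all operators `conf s a`. -/
lemma singular (hσ : 2 ≤ Fintype.card σ) {s : ℝ} (hs : 0 < s) {d : ℕ} (hd : 1 ≤ d)
    {p : MvPolynomial σ ℂ} (hp : p.IsHomogeneous d) (hp0 : p ≠ 0)
    (hc : ∀ a, conf s a p = 0) :
    ∃ (m : ℕ) (c : ℂ), d = 2 * m ∧ p = C c * rsq ^ m ∧ s = (Fintype.card σ : ℝ) / 2 - m := by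
  have he := euler_of_isHomogeneous hp
  have hs' : ((d : ℂ) - 1 + s) ≠ 0 := by
    have : (d : ℝ) - 1 + s ≠ 0 := by
      have : (1 : ℝ) ≤ d := by exact_mod_cast hd
      linarith
    exact_mod_cast this
  -- The vanishing of `conf s a p` says `½ (a·x) Δp = (d - 1 + s) ∂ₐp`; eliminating `Δp` between two
  -- directions gives rotation invariance.
  have hinv : ∀ a b, lin b * dir a p = lin a * dir b p := by
    intro a b
    have h1 := conf_of_euler he s a
    have h2 := conf_of_euler he s b
    rw [hc] at h1 h2
    have h3 : (C ((d : ℂ) - 1 + s) : MvPolynomial σ ℂ) * (lin b * dir a p - lin a * dir b p) = 0 := by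
      linear_combination lin b * h1 - lin a * h2
    exact sub_eq_zero.1 ((mul_eq_zero.1 h3).resolve_left (by rw [C_eq_zero]; exact hs'))
  obtain ⟨m, c, hm, hmc⟩ := eq_rsq_pow_of_invariant hσ d p hp hinv hp0
  refine ⟨m, c, hm, hmc, ?_⟩
  have h1 := sum_X_mul_conf s p he
  have h2 := sum_pderiv_conf s p he
  simp only [hc, mul_zero, map_zero, Finset.sum_const_zero] at h1 h2
  have hl0 : lap p ≠ 0 := by
    intro h
    rw [h] at h1
    have h3 : (C ((d : ℂ) * (d - 1 + s)) : MvPolynomial σ ℂ) * p = 0 := by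
      linear_combination h1
    rcases mul_eq_zero.1 h3 with h4 | h4
    · rw [C_eq_zero] at h4
      exact mul_ne_zero (Nat.cast_ne_zero.2 (by omega)) hs' h4
    · exact hp0 h4
  have h3 := (mul_eq_zero.1 h2.symm).resolve_right hl0
  rw [C_eq_zero] at h3
  have h4 : ((Fintype.card σ : ℝ) - d - 2 * s) / 2 = 0 := by exact_mod_cast h3
  rw [hm] at h4
  push_cast at h4
  linarith

end PolyOp

end

/-! ### Stable spaces of polynomials and the ideals `(r²ʲ)`. -/

noncomputable section

namespace SO2n

open Complex Matrix PolyOp MvPolynomial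

variable {n : ℕ} {E₀ : ℝ}

/-- `E - a` kills the component of degree `a` and multiplies the others by the nonzero scalars `d -
a`, so one component can be removed at a time. -/
lemma euler_mem_split {S : Submodule ℂ (MvPolynomial (Fin n) ℂ)}
    (hS : ∀ p ∈ S, euler p ∈ S) (s : Finset ℕ) :
    ∀ p : ℕ → MvPolynomial (Fin n) ℂ, (∀ d, (p d).IsHomogeneous d) →
      ∑ d ∈ s, p d ∈ S → ∀ d ∈ s, p d ∈ S := by
  induction s using Finset.induction_on with
  | empty => simp
  | insert a s ha ih =>
    intro p hp hsum
    have h1 : ∑ d ∈ s, ((d : ℂ) - a) • p d ∈ S := by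
      have h := sub_mem (hS _ hsum) (S.smul_mem (a : ℂ) hsum)
      convert h using 1
      rw [map_sum, Finset.smul_sum, ← Finset.sum_sub_distrib, Finset.sum_insert ha,
        euler_of_isHomogeneous (hp a), smul_eq_C_mul, sub_self, zero_add]
      refine Finset.sum_congr rfl fun d _ => ?_
      rw [euler_of_isHomogeneous (hp d), sub_smul, smul_eq_C_mul, smul_eq_C_mul]
    have h2 := ih (fun d => ((d : ℂ) - a) • p d)
      (fun d => by rw [smul_eq_C_mul]; exact (hp d).C_mul _) h1
    have h3 : ∀ d ∈ s, p d ∈ S := by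
      intro d hd
      have hne : ((d : ℂ) - a) ≠ 0 := by
        rw [sub_ne_zero, Ne, Nat.cast_inj]
        rintro rfl
        exact ha hd
      have := S.smul_mem ((d : ℂ) - a)⁻¹ (h2 d hd)
      rwa [smul_smul, inv_mul_cancel₀ hne, one_smul] at this
    intro d hd
    rcases Finset.mem_insert.1 hd with rfl | hd
    · rw [Finset.sum_insert ha] at hsum
      have := sub_mem hsum (S.sum_mem h3)
      rwa [add_sub_cancel_right] at this
    · exact h3 d hd

lemma homogeneousComponent_mem {S : Submodule ℂ (MvPolynomial (Fin n) ℂ)}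
    (hS : ∀ p ∈ S, euler p ∈ S) {p : MvPolynomial (Fin n) ℂ} (hp : p ∈ S) (d : ℕ) :
    homogeneousComponent d p ∈ S := by
  by_cases hd : d ∈ Finset.range (p.totalDegree + 1)
  · refine euler_mem_split hS _ (fun d => homogeneousComponent d p)
      (fun d => homogeneousComponent_isHomogeneous d p) ?_ d hd
    rwa [sum_homogeneousComponent]
  · rw [homogeneousComponent_eq_zero]
    · exact S.zero_mem
    · rw [Finset.mem_range] at hd
      omega

/-- A stable space not contained in `W` contains `1` or a polynomial which is singular
modulo `W`. -/
lemma GStable.one_mem_or_exists_singular {S W : Submodule ℂ (MvPolynomial (Fin n) ℂ)}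
    (hS : GStable E₀ S) (hSW : ¬ S ≤ W) :
    1 ∈ S ∨ ∃ d p, 1 ≤ d ∧ p.IsHomogeneous d ∧ p ∈ S ∧ p ∉ W ∧
      ∀ a, conf E₀ a p ∈ W ∧ (conf E₀ a p).IsHomogeneous (d - 1) := by
  classical
  have hex : ∃ d, ∃ p : MvPolynomial (Fin n) ℂ, p.IsHomogeneous d ∧ p ∈ S ∧ p ∉ W := by
    rw [SetLike.not_le_iff_exists] at hSW
    obtain ⟨p, hp, hpW⟩ := hSW
    by_contra! hcon
    apply hpW
    rw [← sum_homogeneousComponent p]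
    exact W.sum_mem fun d _ => hcon d _ (homogeneousComponent_isHomogeneous d p)
      (homogeneousComponent_mem hS.euler_mem hp d)
  -- A homogeneous element of least degree outside `W`: since `conf` lowers the degree by one, its
  -- images must fall into `W`.
  obtain ⟨p, hp, hpS, hpW⟩ := Nat.find_spec hex
  have hmin := fun m => Nat.find_min (H := hex) (m := m)
  set d := Nat.find hex
  have hp0 : p ≠ 0 := by
    rintro rfl
    exact hpW W.zero_mem
  rcases Nat.eq_zero_or_pos d with hd | hd
  · left
    rw [hd] at hp
    have hC := totalDegree_eq_zero_iff_eq_C.1 (hp.totalDegree hp0)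
    have hc : coeff 0 p ≠ 0 := by
      intro h
      rw [h, C_0] at hC
      exact hp0 hC
    have := S.smul_mem (coeff 0 p)⁻¹ hpS
    rw [hC, smul_eq_C_mul, ← C_mul, coeff_zero_C, inv_mul_cancel₀ hc, C_1] at this
    exact this
  · right
    refine ⟨d, p, hd, hp, hpS, hpW, fun a => ?_⟩
    have hh : (conf E₀ a p).IsHomogeneous (d - 1) := by
      apply isHomogeneous_of_euler
      rw [euler_conf_of_euler (euler_of_isHomogeneous hp), Nat.cast_sub hd]
      simp
    refine ⟨?_, hh⟩
    by_contra hW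
    exact hmin (d - 1) (by omega) ⟨_, hh, hS.conf_mem a p hpS, hW⟩

/-- The multiples of `rsq ^ j`. -/
def rsqMultiples (n j : ℕ) : Submodule ℂ (MvPolynomial (Fin n) ℂ) :=
  (Ideal.span {(rsq : MvPolynomial (Fin n) ℂ) ^ j}).restrictScalars ℂ

lemma mem_rsqMultiples {j : ℕ} {p : MvPolynomial (Fin n) ℂ} :
    p ∈ rsqMultiples n j ↔ rsq ^ j ∣ p := Ideal.mem_span_singleton

lemma kStable_rsqMultiples (j : ℕ) : KStable (rsqMultiples n j) where
  euler_mem p hp := by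
    rw [mem_rsqMultiples] at *
    obtain ⟨p, rfl⟩ := hp
    have h : euler ((rsq : MvPolynomial (Fin n) ℂ) ^ j) = C ((2 * j : ℕ) : ℂ) * rsq ^ j :=
      euler_of_isHomogeneous (isHomogeneous_rsq.pow j)
    rw [Derivation.leibniz, h]
    exact dvd_add (dvd_mul_right _ _) ((dvd_mul_left _ _).mul_left _)
  vf_mem B hB p hp := by
    rw [mem_rsqMultiples] at *
    obtain ⟨p, rfl⟩ := hp
    rw [vf_rsq_pow_mul hB]
    exact dvd_mul_right _ _

lemma gStable_rsqMultiples {j : ℕ} (hj : 1 ≤ j) (hE : E₀ = (n : ℝ) / 2 - j) :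
    GStable E₀ (rsqMultiples n j) where
  toKStable := kStable_rsqMultiples j
  lin_mem a p hp := by
    rw [mem_rsqMultiples] at *
    exact hp.mul_left _
  conf_mem a p hp := by
    rw [mem_rsqMultiples] at *
    obtain ⟨p, rfl⟩ := hp
    obtain ⟨m, rfl⟩ : ∃ m, j = m + 1 := ⟨j - 1, by omega⟩
    rw [conf_rsq_pow_mul]
    have h : ((m : ℂ) + 1) * (Fintype.card (Fin n) - 2 * (E₀ : ℂ) - 2 * (m + 1)) = 0 := by
      rw [hE, Fintype.card_fin]
      push_cast
      ring
    rw [h, C_0, zero_mul, add_zero]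
    exact dvd_mul_right _ _

lemma dvd_pderiv {j : ℕ} {p : MvPolynomial (Fin n) ℂ} (i : Fin n) (h : rsq ^ (j + 1) ∣ p) :
    rsq ^ j ∣ pderiv i p := by
  obtain ⟨p, rfl⟩ := h
  rw [← dir_single, dir_rsq_pow_mul]
  exact dvd_add ((pow_dvd_pow _ (Nat.le_succ j)).mul_right _)
    (((dvd_mul_right _ _).mul_right _).mul_left _)

lemma dvd_of_dvd_C_mul {q p : MvPolynomial (Fin n) ℂ} {c : ℂ} (hc : c ≠ 0) (h : q ∣ C c * p) :
    q ∣ p := by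
  have := h.mul_left (C c⁻¹)
  rwa [← mul_assoc, ← C_mul, inv_mul_cancel₀ hc, C_1, one_mul] at this

lemma rsq_ne_zero (hn : 1 ≤ n) : (rsq : MvPolynomial (Fin n) ℂ) ≠ 0 := by
  intro h
  have h1 := dir_rsq (σ := Fin n) (Pi.single ⟨0, hn⟩ 1)
  rw [h, map_zero, lin_single] at h1
  have h2 := (mul_eq_zero.1 h1.symm).resolve_left two_ne_zero
  exact X_ne_zero _ h2

/-- `rsqMultiples n j` contains every stable space which does not contain `1`. -/
lemma GStable.le_rsqMultiples (hn : 2 ≤ n) (hE₀ : 0 < E₀) {j : ℕ} (hj : 1 ≤ j)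
    (hE : E₀ = (n : ℝ) / 2 - j) {S : Submodule ℂ (MvPolynomial (Fin n) ℂ)} (hS : GStable E₀ S)
    (h1 : 1 ∉ S) : S ≤ rsqMultiples n j := by
  by_contra hSW
  rcases hS.one_mem_or_exists_singular hSW with h | ⟨d, p, hd, hp, hpS, hpW, hconf⟩
  · exact h1 h
  apply hpW
  have he := euler_of_isHomogeneous hp
  have hp0 : p ≠ 0 := by
    rintro rfl
    exact hpW (Submodule.zero_mem _)
  -- This is the degree `n - 2E₀` in which `sum_pderiv_conf` gives no information. There `conf E₀ a
  -- p` has degree `2j - 1`, too small for a nonzero multiple of `r²ʲ`, so `p` is genuinely singular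
  -- and hence a multiple of `r²ʲ`.
  by_cases hdj : d = 2 * j
  · have hz : ∀ a, conf E₀ a p = 0 := by
      intro a
      by_contra hne
      have ht := (hconf a).2.totalDegree hne
      obtain ⟨g, hg⟩ := mem_rsqMultiples.1 (hconf a).1
      rw [hg] at hne ht
      have hr := (isHomogeneous_rsq.pow j).totalDegree (left_ne_zero_of_mul hne)
      rw [totalDegree_mul_of_isDomain (left_ne_zero_of_mul hne) (right_ne_zero_of_mul hne),
        hr] at ht
      omega
    obtain ⟨m, c, hm, hc, -⟩ := singular (by simpa using hn) hE₀ hd hp hp0 hz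
    rw [mem_rsqMultiples, hc, show j = m by omega]
    exact dvd_mul_left _ _
  · have hconf' (a) := mem_rsqMultiples.1 (hconf a).1
    obtain ⟨m, rfl⟩ : ∃ m, j = m + 1 := ⟨j - 1, by omega⟩
    -- Differentiation costs one factor `r²`, so `Δp` is divisible only by `r²ᵐ` with `m = j - 1`.
    -- The factor in `r²Δp` restores the lost power, and `sum_X_mul_conf` then makes `p` divisible
    -- by `r²ʲ`.
    have h2 : rsq ^ m ∣ lap p := by
      have h3 := sum_pderiv_conf E₀ p he
      have h4 : rsq ^ m ∣ ∑ i, pderiv i (conf E₀ (Pi.single i 1) p) :=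
        Finset.dvd_sum fun i _ => dvd_pderiv i (hconf' _)
      rw [h3] at h4
      refine dvd_of_dvd_C_mul ?_ h4
      rw [Fintype.card_fin]
      intro h
      have h5 : ((n : ℝ) - d - 2 * E₀) / 2 = 0 := by exact_mod_cast h
      rw [hE] at h5
      push_cast at h5
      apply hdj
      have : (d : ℝ) = 2 * ((m : ℝ) + 1) := by linarith
      exact_mod_cast this
    have h3 := sum_X_mul_conf E₀ p he
    have h4 : rsq ^ (m + 1) ∣ ∑ i, MvPolynomial.X i * conf E₀ (Pi.single i 1) p :=
      Finset.dvd_sum fun i _ => (hconf' _).mul_left _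
    have h5 : (rsq : MvPolynomial (Fin n) ℂ) ^ (m + 1) ∣ C (1 / 2) * (rsq * lap p) := by
      rw [pow_succ']
      exact (mul_dvd_mul_left _ h2).mul_left _
    have h6 := dvd_sub h5 h4
    rw [h3, sub_sub_cancel] at h6
    refine mem_rsqMultiples.2 (dvd_of_dvd_C_mul ?_ h6)
    have h7 : (d : ℝ) * (d - 1 + E₀) ≠ 0 := by
      have : (1 : ℝ) ≤ d := by exact_mod_cast hd
      exact mul_ne_zero (by linarith) (by linarith)
    exact_mod_cast h7

/-- Away from the reduction points, every nonzero stable space contains `1`. -/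
lemma GStable.one_mem (hn : 2 ≤ n) (hE₀ : 0 < E₀)
    (hE : ∀ j : ℕ, 1 ≤ j → E₀ ≠ (n : ℝ) / 2 - j)
    {S : Submodule ℂ (MvPolynomial (Fin n) ℂ)} (hS : GStable E₀ S) (h0 : S ≠ ⊥) : 1 ∈ S := by
  rcases hS.one_mem_or_exists_singular (W := ⊥) (by rwa [le_bot_iff]) with
    h | ⟨d, p, hd, hp, hpS, hpW, hconf⟩
  · exact h
  · obtain ⟨m, c, hm, -, hs⟩ := singular (by simpa using hn) hE₀ hd hp hpW
      (fun a => (Submodule.mem_bot ℂ).1 (hconf a).1)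
    rw [Fintype.card_fin] at hs
    exact absurd hs (hE m (by omega))

lemma eq_top_of_X_mul_mem {S : Submodule ℂ (MvPolynomial (Fin n) ℂ)}
    (hS : ∀ i, ∀ p ∈ S, MvPolynomial.X i * p ∈ S) (h1 : 1 ∈ S) : S = ⊤ := by
  rw [eq_top_iff]
  intro p _
  induction p using MvPolynomial.induction_on with
  | C c =>
    have := S.smul_mem c h1
    rwa [smul_eq_C_mul, mul_one] at this
  | add p q hp hq => exact add_mem (hp trivial) (hq trivial)
  | mul_X p i hp =>
    rw [mul_comm]
    exact hS i p (hp trivial)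

end SO2n

end

/-! ### The decomposition of polynomials under `k`. -/

noncomputable section

attribute [local instance 100] LieRing.ofAssociativeRing

namespace SO2n

open Complex Matrix PolyOp

variable {n : ℕ} {E₀ : ℝ}

lemma eVec_two (hn : 2 ≤ n) : eVec n 2 =
    Pi.single (⟨0, by omega⟩ : Fin n) 1 + I • Pi.single (⟨1, by omega⟩ : Fin n) 1 := by
  rw [eVec_pos le_rfl, ← fVec_succ, ← fVec_succ]
  norm_num

lemma dotProduct_eVec_two (hn : 2 ≤ n) : eVec n 2 ⬝ᵥ eVec n 2 = 0 := by
  rw [eVec_two hn]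
  simp [dotProduct_add]

lemma zlin_eq (hn : 2 ≤ n) : zlin n = MvPolynomial.X ⟨0, by omega⟩ +
    MvPolynomial.C I * MvPolynomial.X ⟨1, by omega⟩ := by
  rw [zlin, eVec_two hn, map_add, map_smul, lin_single, lin_single, MvPolynomial.smul_eq_C_mul]

lemma euler_zlin_pow (l : ℕ) : euler (zlin n ^ l) = MvPolynomial.C (l : ℂ) * zlin n ^ l := by
  induction l with
  | zero => simp
  | succ l ih =>
    rw [pow_succ', zlin, euler_lin_mul, ← zlin, ih]
    simp
    ring

lemma dir_eVec_zlin_pow (hn : 2 ≤ n) (l : ℕ) : dir (eVec n 2) (zlin n ^ l) = 0 := by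
  induction l with
  | zero => simp
  | succ l ih =>
    rw [pow_succ', zlin, dir_lin_mul, ← zlin, ih, dotProduct_eVec_two hn]
    simp

lemma lap_zlin_pow (hn : 2 ≤ n) (l : ℕ) : lap (zlin n ^ l) = 0 := by
  induction l with
  | zero => simp [lap_apply]
  | succ l ih =>
    rw [pow_succ', zlin, lap_lin_mul, ← zlin, ih, dir_eVec_zlin_pow hn]
    simp

/-- The eigenvalue of `r²Δ` on `r²ᵏ` times the harmonic polynomials of degree `l`. -/
def rsqLapValue (n l k : ℕ) : ℂ := 2 * k * (2 * k + 2 * l + n - 2)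

lemma euler_generator (l k : ℕ) : euler (zlin n ^ l * (-rsq) ^ k) =
    MvPolynomial.C ((l : ℂ) + 2 * k) * (zlin n ^ l * (-rsq) ^ k) := by
  induction k with
  | zero => rw [pow_zero, mul_one, euler_zlin_pow, Nat.cast_zero, mul_zero, add_zero]
  | succ k ih =>
    rw [pow_succ', show zlin n ^ l * (-rsq * (-rsq) ^ k) = rsq * -(zlin n ^ l * (-rsq) ^ k) by ring,
      euler_rsq_mul, map_neg, ih]
    simp [C_two]
    ring

lemma rsq_lap_generator (hn : 2 ≤ n) (l k : ℕ) : rsq * lap (zlin n ^ l * (-rsq) ^ k) =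
    MvPolynomial.C (rsqLapValue n l k) * (zlin n ^ l * (-rsq) ^ k) := by
  induction k with
  | zero => simp [lap_zlin_pow hn, rsqLapValue]
  | succ k ih =>
    rw [pow_succ', show zlin n ^ l * (-rsq * (-rsq) ^ k) = rsq * -(zlin n ^ l * (-rsq) ^ k) by ring,
      lap_rsq_mul, map_neg, map_neg, euler_generator, mul_neg, ih]
    simp [rsqLapValue, C_two]
    ring

/-- The joint eigenspace of `E` and `r²Δ` containing `zˡ r²ᵏ`. -/
def eigenPolys (n l k : ℕ) : Submodule ℂ (MvPolynomial (Fin n) ℂ) where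
  carrier := {p | euler p = ((l : ℂ) + 2 * k) • p ∧ rsq * lap p = rsqLapValue n l k • p}
  add_mem' := by
    rintro p q ⟨h1, h2⟩ ⟨h3, h4⟩
    exact ⟨by rw [map_add, h1, h3, smul_add], by rw [map_add, mul_add, h2, h4, smul_add]⟩
  zero_mem' := by simp
  smul_mem' := by
    rintro c p ⟨h1, h2⟩
    exact ⟨by rw [Derivation.map_smul, h1, smul_comm],
      by rw [map_smul, mul_smul_comm, h2, smul_comm]⟩

lemma kStable_eigenPolys (n l k : ℕ) : KStable (eigenPolys n l k) where
  euler_mem p hp := by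
    rw [hp.1]
    exact (eigenPolys n l k).smul_mem _ hp
  vf_mem B hB p hp := by
    refine ⟨?_, ?_⟩
    · rw [← vf_euler, hp.1, Derivation.map_smul]
    · have h := vf_rsq_pow_mul hB 1 (lap p)
      rw [pow_one, vf_lap hB] at h
      rw [← h, hp.2, Derivation.map_smul]

/-- The operator `r²Δ + iE`. -/
def separator (n : ℕ) : Module.End ℂ (MvPolynomial (Fin n) ℂ) :=
  (LinearMap.mulLeft ℂ rsq).comp lap + I • euler.toLinearMap

lemma eigenPolys_le (l k : ℕ) : eigenPolys n l k ≤
    (separator n).eigenspace (rsqLapValue n l k + I * ((l : ℂ) + 2 * k)) := by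
  intro p hp
  rw [Module.End.mem_eigenspace_iff]
  have h : separator n p = rsq * lap p + I • euler p := rfl
  rw [h, hp.1, hp.2, add_smul (rsqLapValue n l k), mul_smul]

/-- Both eigenvalues are real, so real and imaginary parts separate them. For equal degree `l + 2k`,
the difference of the `r²Δ`-values is `2 (k - k') (l + l' + n - 2)`, whose last factor is positive.
-/
lemma separator_value_injective (hn : 3 ≤ n) : Function.Injective
    (fun p : ℕ × ℕ => rsqLapValue n p.1 p.2 + I * ((p.1 : ℂ) + 2 * p.2)) := by
  rintro ⟨l, k⟩ ⟨l', k'⟩ h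
  have e1 (l k : ℕ) : rsqLapValue n l k + I * ((l : ℂ) + 2 * k) =
      ((2 * k * (2 * k + 2 * l + n - 2) : ℝ) : ℂ) + ((l + 2 * k : ℝ) : ℂ) * I := by
    simp [rsqLapValue]; ring
  simp only [e1] at h
  have hre := congrArg Complex.re h
  have him := congrArg Complex.im h
  simp only [add_re, add_im, ofReal_re, ofReal_im, re_ofReal_mul, im_ofReal_mul, I_re, I_im,
    mul_zero, add_zero, zero_add, mul_one] at hre him
  have hre' : (2 * k * (2 * k + 2 * l + n - 2) : ℤ) = 2 * k' * (2 * k' + 2 * l' + n - 2) := by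
    exact_mod_cast hre
  have him' : (l + 2 * k : ℤ) = l' + 2 * k' := by exact_mod_cast him
  have hl : (l' : ℤ) = l + 2 * k - 2 * k' := by linarith
  have hprod : ((k : ℤ) - k') * (l + l' + n - 2) = 0 := by
    rw [hl] at hre' ⊢
    linarith
  have hpos : ((l : ℤ) + l' + n - 2) ≠ 0 := by omega
  have := (mul_eq_zero.1 hprod).resolve_right hpos
  ext <;> simp <;> omega

/-- The `U(k)`-submodule of the model generated by `zˡ (-r²)ᵏ`. -/
def modelUkv (n : ℕ) (E₀ : ℝ) (l k : ℕ) : Submodule (Uk n) (Model n E₀) :=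
  Submodule.span (Uk n) {Model.mk E₀ (zlin n ^ l * (-rsq) ^ k)}

lemma modelUkv_le (hn : 2 ≤ n) (l k : ℕ) :
    modelUkv n E₀ l k ≤ (kStable_eigenPolys n l k).toSubmodule E₀ := by
  refine Submodule.span_le.2 ?_
  rintro _ rfl
  rw [SetLike.mem_coe, KStable.mk_mem]
  exact ⟨by rw [euler_generator, MvPolynomial.smul_eq_C_mul],
    by rw [rsq_lap_generator hn, MvPolynomial.smul_eq_C_mul]⟩

lemma generator_mem (l k : ℕ) : zlin n ^ l * (-rsq) ^ k ∈ polysK (modelUkv n E₀ l k) :=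
  mem_polysK.2 (Submodule.mem_span_singleton_self _)

lemma KStable.iSup_le {ι : Type*} {S : Submodule ℂ (MvPolynomial (Fin n) ℂ)} (hS : KStable S)
    (l k : ι → ℕ) (h : ∀ i, zlin n ^ l i * (-rsq) ^ k i ∈ S) :
    ⨆ i, modelUkv n E₀ (l i) (k i) ≤ hS.toSubmodule E₀ := by
  refine _root_.iSup_le fun i => Submodule.span_le.2 ?_
  rintro _ rfl
  exact h i

/-- Each piece lies in an eigenspace of the single operator `separator n`, and the eigenvalues are
distinct. -/
lemma iSupIndep_modelUkv (hn : 3 ≤ n) (E₀ : ℝ) :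
    iSupIndep (fun p : ℕ × ℕ => modelUkv n E₀ p.1 p.2) := by
  have h1 : iSupIndep fun p : ℕ × ℕ => eigenPolys n p.1 p.2 :=
    ((Module.End.eigenspaces_iSupIndep (separator n)).comp (separator_value_injective hn)).mono
      fun p => eigenPolys_le p.1 p.2
  rw [iSupIndep_iff_finsetSum_eq_zero_imp_eq_zero] at h1 ⊢
  intro s f hf hsum i hi
  exact h1 s f (fun i hi => modelUkv_le (by omega) _ _ (hf i hi)) hsum i hi

lemma KStable.comap_rsq_pow {S : Submodule ℂ (MvPolynomial (Fin n) ℂ)} (hS : KStable S) (j : ℕ) :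
    KStable (S.comap (LinearMap.mulLeft ℂ (rsq ^ j))) where
  euler_mem p hp := by
    replace hp : rsq ^ j * p ∈ S := hp
    have h : euler ((rsq : MvPolynomial (Fin n) ℂ) ^ j) =
        MvPolynomial.C ((2 * j : ℕ) : ℂ) * rsq ^ j :=
      euler_of_isHomogeneous (isHomogeneous_rsq.pow j)
    have h1 := sub_mem (hS.euler_mem _ hp) (S.smul_mem ((2 * j : ℕ) : ℂ) hp)
    rw [Derivation.leibniz, h, MvPolynomial.smul_eq_C_mul] at h1
    change rsq ^ j * euler p ∈ S
    convert h1 using 1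
    simp only [smul_eq_mul]
    ring
  vf_mem B hB p hp := by
    change rsq ^ j * vf B p ∈ S
    rw [← vf_rsq_pow_mul hB]
    exact hS.vf_mem B hB _ hp

/-- A rotation turns `xᵢ` into a combination of all coordinates, so the condition is stable only
when imposed for every `i` simultaneously. -/
lemma KStable.comap_X {S : Submodule ℂ (MvPolynomial (Fin n) ℂ)} (hS : KStable S) :
    KStable (⨅ i, S.comap (LinearMap.mulLeft ℂ (MvPolynomial.X i))) where
  euler_mem p hp := by
    rw [Submodule.mem_iInf] at hp ⊢
    intro i
    replace hp : MvPolynomial.X i * p ∈ S := hp i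
    change MvPolynomial.X i * euler p ∈ S
    have h := sub_mem (hS.euler_mem _ hp) hp
    rw [← lin_single, euler_lin_mul, add_sub_cancel_left, lin_single] at h
    exact h
  vf_mem B hB p hp := by
    rw [Submodule.mem_iInf] at hp ⊢
    intro i
    replace hp (i) : MvPolynomial.X i * p ∈ S := hp i
    change MvPolynomial.X i * vf B p ∈ S
    have h := hS.vf_mem B hB _ (hp i)
    rw [← lin_single, vf_lin_mul, lin_single] at h
    have h2 : lin (B *ᵥ Pi.single i 1) * p ∈ S := by
      rw [lin_apply, Finset.sum_mul]
      refine S.sum_mem fun j _ => ?_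
      rw [mul_assoc, ← MvPolynomial.smul_eq_C_mul]
      exact S.smul_mem _ (hp j)
    have h3 := sub_mem h h2
    rwa [add_sub_cancel_left] at h3

lemma pderiv_zlin_pow (i : Fin n) (l : ℕ) :
    MvPolynomial.pderiv i (zlin n ^ l) =
      MvPolynomial.C (eVec n 2 i * l) * zlin n ^ (l - 1) := by
  rw [← dir_single, Derivation.leibniz_pow, zlin, dir_lin, ← zlin, single_one_dotProduct]
  simp
  ring

/-- The products of the coordinates with `zˡ` are obtained from powers of `z` by rotations and
multiplication with `r²`. -/
lemma X_mul_zlin_pow_mem (hn : 3 ≤ n) {S : Submodule ℂ (MvPolynomial (Fin n) ℂ)}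
    (hS : KStable S) (hr : ∀ p ∈ S, rsq * p ∈ S) (hz : ∀ l, zlin n ^ l ∈ S) (i : Fin n) (l : ℕ) :
    MvPolynomial.X i * zlin n ^ l ∈ S := by
  set i₀ : Fin n := ⟨0, by omega⟩ with hi₀
  set i₁ : Fin n := ⟨1, by omega⟩ with hi₁
  have h01 : i₀ ≠ i₁ := by simp [hi₀, hi₁]
  have hzz : zlin n = MvPolynomial.X i₀ + MvPolynomial.C I * MvPolynomial.X i₁ :=
    zlin_eq (by omega)
  have he0 : eVec n 2 i₀ = 1 := by
    rw [eVec_two (by omega), ← hi₀, ← hi₁]; simp [h01]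
  have hej {j : Fin n} (h0 : j ≠ i₀) (h1 : j ≠ i₁) : eVec n 2 j = 0 := by
    rw [eVec_two (by omega), ← hi₀, ← hi₁]; simp [h0, h1]
  have hrot (j : Fin n) {p : MvPolynomial (Fin n) ℂ} (hp : p ∈ S) :
      MvPolynomial.X j * MvPolynomial.pderiv i₀ p -
        MvPolynomial.X i₀ * MvPolynomial.pderiv j p ∈ S := by
    have hB : (vecMulVec (Pi.single j 1) (Pi.single i₀ 1) -
        vecMulVec (Pi.single i₀ 1) (Pi.single j 1) : Matrix (Fin n) (Fin n) ℂ)ᵀ =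
        -(vecMulVec (Pi.single j 1) (Pi.single i₀ 1) -
          vecMulVec (Pi.single i₀ 1) (Pi.single j 1)) := by
      ext i j; simp [vecMulVec_apply]; ring
    have h := hS.vf_mem _ hB p hp
    rwa [vf_sub, vf_vecMulVec, vf_vecMulVec, lin_single, lin_single, dir_single,
      dir_single] at h
  -- For these `j` one has `∂ⱼ z = 0`, so the rotation sends `zˡ⁺¹` to `(l + 1) xⱼ zˡ`.
  have hother {j : Fin n} (h0 : j ≠ i₀) (h1 : j ≠ i₁) : MvPolynomial.X j * zlin n ^ l ∈ S := by
    have h := hrot j (hz (l + 1))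
    rw [pderiv_zlin_pow, pderiv_zlin_pow, he0, hej h0 h1] at h
    have h2 := S.smul_mem ((l : ℂ) + 1)⁻¹ h
    rw [MvPolynomial.smul_eq_C_mul] at h2
    convert h2 using 1
    have hl : MvPolynomial.C (((l : ℂ) + 1)⁻¹) * MvPolynomial.C ((l : ℂ) + 1) =
        (1 : MvPolynomial (Fin n) ℂ) := by
      rw [← MvPolynomial.C_mul, inv_mul_cancel₀ (Nat.cast_add_one_ne_zero l), MvPolynomial.C_1]
    simp only [one_mul, zero_mul, Nat.cast_add, Nat.cast_one, Nat.add_sub_cancel,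
      MvPolynomial.C_0, mul_zero, sub_zero]
    linear_combination (-MvPolynomial.X j * zlin n ^ l) * hl
  have hzero : MvPolynomial.X i₀ * zlin n ^ l ∈ S := by
    -- Rotate `xⱼ zˡ` once more and sum over `j`. With `x_{i₀}² + x_{i₁}² = z (2x_{i₀} - z)`, the
    -- sum is `l r² zˡ⁻¹ + l zˡ⁺¹ - (2l + n - 2) x_{i₀} zˡ`. The truncated exponent `l - 1` is
    -- harmless because of the factor `l`.
    have hterm : ∀ j ∈ (Finset.univ.erase i₀).erase i₁,
        MvPolynomial.C (l : ℂ) * zlin n ^ (l - 1) * MvPolynomial.X j ^ 2 -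
          MvPolynomial.X i₀ * zlin n ^ l ∈ S := by
      intro j hj
      simp only [Finset.mem_erase, Finset.mem_univ, and_true] at hj
      have h := hrot j (hother hj.2 hj.1)
      rw [Derivation.leibniz, Derivation.leibniz, pderiv_zlin_pow,
        pderiv_zlin_pow, he0, hej hj.2 hj.1, MvPolynomial.pderiv_X_self,
        MvPolynomial.pderiv_X_of_ne hj.2] at h
      convert h using 1
      simp
      ring
    have hsum := S.sum_mem hterm
    rw [Finset.sum_sub_distrib, ← Finset.mul_sum, Finset.sum_const,
      Finset.card_erase_of_mem (by simp [h01.symm]), Finset.card_erase_of_mem (by simp),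
      Finset.card_univ, Fintype.card_fin, ← Nat.cast_smul_eq_nsmul ℂ,
      MvPolynomial.smul_eq_C_mul] at hsum
    have hsq : ∑ j ∈ (Finset.univ.erase i₀).erase i₁, (MvPolynomial.X j ^ 2 : MvPolynomial _ ℂ) =
        rsq - zlin n * (2 * MvPolynomial.X i₀ - zlin n) := by
      have h1 := Finset.add_sum_erase Finset.univ
        (fun j => (MvPolynomial.X j ^ 2 : MvPolynomial (Fin n) ℂ)) (Finset.mem_univ i₀)
      have h2 := Finset.add_sum_erase (Finset.univ.erase i₀)
        (fun j => (MvPolynomial.X j ^ 2 : MvPolynomial (Fin n) ℂ)) (a := i₁) (by simp [h01.symm])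
      have hI : (MvPolynomial.C I : MvPolynomial (Fin n) ℂ) ^ 2 = -1 := by
        rw [← map_pow, I_sq]; simp
      rw [← h2] at h1
      rw [rsq, ← h1, hzz]
      linear_combination (-MvPolynomial.X i₁ ^ 2) * hI
    have hlz : MvPolynomial.C (l : ℂ) * (zlin n ^ (l - 1) * zlin n) =
        MvPolynomial.C (l : ℂ) * zlin n ^ l := by
      cases l with
      | zero => simp
      | succ l => rw [Nat.add_sub_cancel, pow_succ]
    have hA : MvPolynomial.C (l : ℂ) * (rsq * zlin n ^ (l - 1)) ∈ S := by
      rw [← MvPolynomial.smul_eq_C_mul]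
      exact S.smul_mem _ (hr _ (hz _))
    have hB : MvPolynomial.C (l : ℂ) * zlin n ^ (l + 1) ∈ S := by
      rw [← MvPolynomial.smul_eq_C_mul]
      exact S.smul_mem _ (hz _)
    have hc : ((2 * l + (n - 2 : ℕ) : ℕ) : ℂ) ≠ 0 := by
      rw [Nat.cast_ne_zero]; omega
    have hfin := S.smul_mem ((2 * l + (n - 2 : ℕ) : ℕ) : ℂ)⁻¹ (sub_mem (add_mem hA hB) hsum)
    rw [hsq, MvPolynomial.smul_eq_C_mul] at hfin
    convert hfin using 1
    have hcc : MvPolynomial.C (((2 * l + (n - 2 : ℕ) : ℕ) : ℂ)⁻¹) *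
        MvPolynomial.C (((2 * l + (n - 2 : ℕ) : ℕ) : ℂ)) = (1 : MvPolynomial (Fin n) ℂ) := by
      rw [← MvPolynomial.C_mul, inv_mul_cancel₀ hc, MvPolynomial.C_1]
    have hn2 : (n - 1 - 1 : ℕ) = n - 2 := by omega
    have hC2 : (MvPolynomial.C (((2 * l + (n - 2 : ℕ) : ℕ) : ℂ)) : MvPolynomial (Fin n) ℂ) =
        2 * MvPolynomial.C (l : ℂ) + MvPolynomial.C ((n - 2 : ℕ) : ℂ) := by
      rw [Nat.cast_add, Nat.cast_mul, map_add, map_mul]; rfl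
    rw [hn2]
    generalize MvPolynomial.C (((2 * l + (n - 2 : ℕ) : ℕ) : ℂ)⁻¹) = y at hcc ⊢
    rw [hC2] at hcc
    linear_combination (-MvPolynomial.X i₀ * zlin n ^ l) * hcc -
      y * (2 * MvPolynomial.X i₀ - zlin n) * hlz
  by_cases h0 : i = i₀
  · rw [h0]; exact hzero
  by_cases h1 : i = i₁
  · have h := S.smul_mem (-I) (sub_mem (hz (l + 1)) hzero)
    rw [MvPolynomial.smul_eq_C_mul] at h
    convert h using 1
    have hI : (MvPolynomial.C I : MvPolynomial (Fin n) ℂ) ^ 2 = -1 := by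
      rw [← map_pow, I_sq]; simp
    rw [h1, pow_succ, MvPolynomial.C_neg]
    linear_combination (MvPolynomial.X i₁ * zlin n ^ l) * hI +
      MvPolynomial.C I * zlin n ^ l * hzz
  · exact hother h0 h1

/-- The polynomials that multiplication by `r²`, or by all coordinates, sends into the sum form
`K`-stable spaces, so closure need only be tested on the generators `zˡ (-r²)ᵏ`. -/
lemma iSup_modelUkv (hn : 3 ≤ n) (E₀ : ℝ) :
    ⨆ p : ℕ × ℕ, modelUkv n E₀ p.1 p.2 = ⊤ := by
  set T := ⨆ p : ℕ × ℕ, modelUkv n E₀ p.1 p.2 with hT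
  have hS := kStable_polysK T
  have hgen (l k : ℕ) : zlin n ^ l * (-rsq) ^ k ∈ polysK T :=
    le_iSup (fun p : ℕ × ℕ => modelUkv n E₀ p.1 p.2) (l, k) (generator_mem l k)
  have hr : ∀ p ∈ polysK T, rsq * p ∈ polysK T := by
    intro p hp
    have hle : T ≤ (hS.comap_rsq_pow 1).toSubmodule E₀ := by
      refine KStable.iSup_le _ _ _ fun p => ?_
      change rsq ^ 1 * (zlin n ^ p.1 * (-rsq) ^ p.2) ∈ polysK T
      have := neg_mem (hgen p.1 (p.2 + 1))
      convert this using 1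
      ring
    have h : rsq ^ 1 * p ∈ polysK T := hle hp
    rwa [pow_one] at h
  have hz (l : ℕ) : zlin n ^ l ∈ polysK T := by
    have := hgen l 0
    rwa [pow_zero, mul_one] at this
  have hX : ∀ i, ∀ p ∈ polysK T, MvPolynomial.X i * p ∈ polysK T := by
    intro i p hp
    have hle : T ≤ hS.comap_X.toSubmodule E₀ := by
      refine KStable.iSup_le _ _ _ fun p => ?_
      rw [Submodule.mem_iInf]
      intro i
      change MvPolynomial.X i * (zlin n ^ p.1 * (-rsq) ^ p.2) ∈ polysK T
      induction p.2 with
      | zero =>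
        rw [pow_zero, mul_one]
        exact X_mul_zlin_pow_mem hn hS hr hz i p.1
      | succ k ih =>
        have := neg_mem (hr _ ih)
        convert this using 1
        ring
    have hp' : p ∈ ⨅ i, (polysK T).comap (LinearMap.mulLeft ℂ (MvPolynomial.X i)) := hle hp
    exact (Submodule.mem_iInf _).1 hp' i
  have htop := eq_top_of_X_mul_mem hX (by simpa using hgen 0 0)
  rw [eq_top_iff]
  intro p _
  have : (Model.mk E₀).symm p ∈ polysK T := by rw [htop]; trivial
  exact this

/-- The sum of the `modelUkv n E₀ l (j + k)` consists of the multiples of `rsq ^ j`. -/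
lemma iSup_modelUkv_add (hn : 3 ≤ n) (E₀ : ℝ) (j : ℕ) :
    ⨆ p : ℕ × ℕ, modelUkv n E₀ p.1 (j + p.2) = (kStable_rsqMultiples j).toSubmodule E₀ := by
  apply le_antisymm
  · refine KStable.iSup_le _ _ _ fun p => ?_
    rw [mem_rsqMultiples, pow_add, neg_pow rsq j]
    exact ((dvd_mul_left _ _).mul_right _).mul_left _
  · intro p hp
    obtain ⟨q, hq⟩ := mem_rsqMultiples.1 (KStable.mk_mem (E₀ := E₀) _ |>.1 hp)
    set T := ⨆ p : ℕ × ℕ, modelUkv n E₀ p.1 (j + p.2) with hT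
    -- The polynomials whose product with `r²ʲ` lies in `T` form a `K`-stable space containing every
    -- generator, and the generators already give the whole model.
    have hle : (⊤ : Submodule (Uk n) (Model n E₀)) ≤
        ((kStable_polysK T).comap_rsq_pow j).toSubmodule E₀ := by
      rw [← iSup_modelUkv hn E₀]
      refine KStable.iSup_le _ _ _ fun p => ?_
      change rsq ^ j * (zlin n ^ p.1 * (-rsq) ^ p.2) ∈ polysK T
      have h : zlin n ^ p.1 * (-rsq) ^ (j + p.2) ∈ polysK T :=
        le_iSup (fun p : ℕ × ℕ => modelUkv n E₀ p.1 (j + p.2)) p (generator_mem p.1 (j + p.2))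
      have h2 := (polysK T).smul_mem ((-1) ^ j) h
      rw [MvPolynomial.smul_eq_C_mul] at h2
      convert h2 using 1
      rw [pow_add, neg_pow rsq j, map_pow, map_neg, MvPolynomial.C_1]
      have : ((-1 : MvPolynomial (Fin n) ℂ) ^ j) * (-1) ^ j = 1 := by
        rw [← mul_pow]; simp
      linear_combination (-rsq ^ j * (zlin n ^ p.1 * (-rsq) ^ p.2)) * this
    have h : rsq ^ j * q ∈ polysK T := hle (x := Model.mk E₀ q) trivial
    rw [← hq] at h
    exact h

end SO2n

end

/-! ### Abstract submodule arguments, and transfer from the model to `N(λ)`. -/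

noncomputable section

attribute [local instance 100] LieRing.ofAssociativeRing

section Abstract

lemma iSupIndep_span_singleton_equiv {R M M' ι : Type*} [Ring R] [AddCommGroup M] [Module R M]
    [AddCommGroup M'] [Module R M'] (e : M ≃ₗ[R] M') (x : ι → M)
    (h : iSupIndep fun i => Submodule.span R {e (x i)}) :
    iSupIndep fun i => Submodule.span R {x i} := by
  rw [← iSupIndep_map_orderIso_iff (Submodule.orderIsoMapComap e)]
  convert h using 2 with i
  simp [Submodule.map_span]

lemma iSup_span_singleton_equiv {R M M' ι : Type*} [Ring R] [AddCommGroup M] [Module R M]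
    [AddCommGroup M'] [Module R M'] (e : M ≃ₗ[R] M') (x : ι → M) :
    ⨆ i, Submodule.span R {x i} =
      (⨆ i, Submodule.span R {e (x i)}).comap (e : M →ₗ[R] M') := by
  have h : (⨆ i, Submodule.span R {x i}).map (e : M →ₗ[R] M') =
      ⨆ i, Submodule.span R {e (x i)} := by
    simp [Submodule.map_iSup, Submodule.map_span]
  rw [← h, Submodule.comap_map_eq_of_injective e.injective]

lemma maxProper_eq {A M : Type*} [Ring A] [AddCommGroup M] [Module A M] {W : Submodule A M}
    (hW : W ≠ ⊤) (hmax : ∀ S : Submodule A M, S ≠ ⊤ → S ≤ W) :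
    LieInduced.maxProper A M = W :=
  le_antisymm (sSup_le fun S hS => hmax S hS) (le_sSup hW)

lemma isCoatom_of_forall_le {A M : Type*} [Ring A] [AddCommGroup M] [Module A M]
    {W : Submodule A M} (hW : W ≠ ⊤) (hmax : ∀ S : Submodule A M, S ≠ ⊤ → S ≤ W) :
    IsCoatom W := by
  refine ⟨hW, fun S hS => ?_⟩
  by_contra h
  exact not_le_of_gt hS (hmax S h)

/-- If the submodules `H (l, k)` decompose `M` and the ones with `j ≤ k` add up to `W`, then the
remaining ones decompose the quotient by `W`. -/
lemma exists_directSum_equiv_quotient {F A M : Type*} [CommRing F] [Ring A] [Algebra F A]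
    (B : Subalgebra F A) [AddCommGroup M] [Module A M] (H : ℕ → ℕ → Submodule B M)
    (hind : iSupIndep fun p : ℕ × ℕ => H p.1 p.2) (htop : ⨆ p : ℕ × ℕ, H p.1 p.2 = ⊤) (j : ℕ)
    (W : Submodule A M) (hW : W.restrictScalars B = ⨆ p : ℕ × ℕ, H p.1 (j + p.2)) :
    ∃ ψ : (⨁ p : ℕ × Fin j, H p.1 p.2) ≃ₗ[B] (M ⧸ W),
      ∀ (p : ℕ × Fin j) (x : H p.1 p.2),
        ψ (DirectSum.lof B (ℕ × Fin j) (fun p => H p.1 p.2) p x) =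
          Submodule.Quotient.mk (x : M) := by
  classical
  let T : ℕ × Fin j → Submodule B M := fun p => H p.1 p.2
  let c : (⨁ p, T p) →ₗ[B] M := DirectSum.coeLinearMap T
  let ψ : (⨁ p, T p) →ₗ[B] (M ⧸ W) := (W.mkQ.restrictScalars B).comp c
  have hinj : Function.Injective fun p : ℕ × Fin j => (p.1, (p.2 : ℕ)) := by
    rintro ⟨a, b⟩ ⟨a', b'⟩ h
    simp only [Prod.mk.injEq] at h
    exact Prod.ext h.1 (Fin.ext h.2)
  have hTind : iSupIndep T := hind.comp hinj
  have hrange : LinearMap.range c = ⨆ p, T p := (Submodule.iSup_eq_range_dfinsupp_lsum T).symm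
  have hdisj : Disjoint (⨆ p, T p) (W.restrictScalars B) := by
    have h := hind.disjoint_biSup_biSup (s := {p : ℕ × ℕ | p.2 < j}) (t := {p : ℕ × ℕ | j ≤ p.2})
      (Set.disjoint_left.2 fun p (hp : p.2 < j) (hq : j ≤ p.2) => by omega)
    refine h.mono ?_ ?_
    · exact iSup_le fun p => le_iSup₂_of_le (p.1, (p.2 : ℕ)) p.2.2 le_rfl
    · rw [hW]
      exact iSup_le fun p => le_iSup₂_of_le (p.1, j + p.2) (Nat.le_add_right j p.2) le_rfl
  have hsup : (⨆ p, T p) ⊔ W.restrictScalars B = ⊤ := by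
    rw [eq_top_iff, ← htop]
    refine iSup_le fun p => ?_
    by_cases hp : p.2 < j
    · exact le_sup_of_le_left (le_iSup T (p.1, ⟨p.2, hp⟩))
    · refine le_sup_of_le_right ?_
      rw [hW]
      refine le_trans (le_of_eq ?_) (le_iSup (fun p : ℕ × ℕ => H p.1 (j + p.2)) (p.1, p.2 - j))
      simp only
      rw [Nat.add_sub_cancel' (not_lt.1 hp)]
  have hbij : Function.Bijective ψ := by
    constructor
    · intro x y hxy
      have h1 : c x - c y ∈ W.restrictScalars B := (Submodule.Quotient.eq W).1 hxy
      have h2 : c x - c y ∈ ⨆ p, T p := by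
        rw [← hrange]
        exact sub_mem ⟨x, rfl⟩ ⟨y, rfl⟩
      exact hTind.dfinsupp_lsum_injective
        (sub_eq_zero.1 (Submodule.disjoint_def.1 hdisj _ h2 h1))
    · intro y
      obtain ⟨m, rfl⟩ := Submodule.Quotient.mk_surjective W y
      have hm : m ∈ (⨆ p, T p) ⊔ W.restrictScalars B := by rw [hsup]; trivial
      obtain ⟨a, ha, w, hw, rfl⟩ := Submodule.mem_sup.1 hm
      rw [← hrange] at ha
      obtain ⟨x, rfl⟩ := ha
      refine ⟨x, (Submodule.Quotient.eq W).2 ?_⟩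
      rw [sub_add_cancel_left]
      exact W.neg_mem hw
  refine ⟨LinearEquiv.ofBijective ψ hbij, fun p x => ?_⟩
  change Submodule.Quotient.mk (DirectSum.coeLinearMap T (DirectSum.lof B _ _ p x)) = _
  rw [DirectSum.coeLinearMap_lof]

end Abstract

namespace SO2n

variable {n : ℕ} {E₀ : ℝ}

lemma iSupIndep_Ukv (hn : 3 ≤ n) (E₀ : ℝ) : iSupIndep fun p : ℕ × ℕ => Ukv n E₀ p.1 p.2 := by
  refine iSupIndep_span_singleton_equiv ((equivModel (by omega) E₀).restrictScalars (Uk n))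
    (fun p : ℕ × ℕ => v n E₀ p.1 p.2) ?_
  convert iSupIndep_modelUkv hn E₀ using 2 with p
  rw [LinearEquiv.restrictScalars_apply, equivModel_v]
  rfl

lemma iSup_Ukv_comap {ι : Type*} (hn : 1 ≤ n) (E₀ : ℝ) (l k : ι → ℕ) :
    ⨆ i, Ukv n E₀ (l i) (k i) = (⨆ i, modelUkv n E₀ (l i) (k i)).comap
      ((equivModel hn E₀).restrictScalars (Uk n) : N n E₀ →ₗ[Uk n] Model n E₀) := by
  have h := iSup_span_singleton_equiv ((equivModel hn E₀).restrictScalars (Uk n))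
    (fun i => v n E₀ (l i) (k i))
  refine h.trans ?_
  congr 2
  funext i
  rw [LinearEquiv.restrictScalars_apply, equivModel_v]
  rfl

lemma iSup_Ukv (hn : 3 ≤ n) (E₀ : ℝ) : ⨆ p : ℕ × ℕ, Ukv n E₀ p.1 p.2 = ⊤ := by
  rw [iSup_Ukv_comap (by omega) E₀ (fun p : ℕ × ℕ => p.1) (fun p => p.2), iSup_modelUkv hn,
    Submodule.comap_top]

/-- The largest proper submodule of `N(λ)` for `E₀ = n/2 - j`. -/
def maxSubmodule (hn : 1 ≤ n) {j : ℕ} (hj : 1 ≤ j) (hE : E₀ = (n : ℝ) / 2 - j) :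
    Submodule (U n) (N n E₀) :=
  (gStable_rsqMultiples hj hE).toSubmodule.comap (equivModel hn E₀ : N n E₀ →ₗ[U n] Model n E₀)

lemma restrictScalars_maxSubmodule (hn : 3 ≤ n) {j : ℕ} (hj : 1 ≤ j)
    (hE : E₀ = (n : ℝ) / 2 - j) :
    (maxSubmodule (by omega) hj hE).restrictScalars (Uk n) =
      ⨆ p : ℕ × ℕ, Ukv n E₀ p.1 (j + p.2) := by
  rw [iSup_Ukv_comap (by omega) E₀ (fun p : ℕ × ℕ => p.1) (fun p => j + p.2),
    iSup_modelUkv_add hn]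
  rfl

lemma eq_top_of_one_mem {T : Submodule (U n) (Model n E₀)}
    (h : (1 : MvPolynomial (Fin n) ℂ) ∈ polys T) :
    T = ⊤ := by
  have h1 := eq_top_of_X_mul_mem (S := polys T) (fun i p hp => by
    rw [← PolyOp.lin_single]; exact (gStable_polys T).lin_mem _ p hp) h
  rw [eq_top_iff]
  intro p _
  have : (Model.mk E₀).symm p ∈ polys T := by rw [h1]; trivial
  exact this

lemma maxSubmodule_ne_top (hn : 1 ≤ n) {j : ℕ} (hj : 1 ≤ j) (hE : E₀ = (n : ℝ) / 2 - j) :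
    maxSubmodule hn hj hE ≠ ⊤ := by
  intro h
  have h1 : vTop n E₀ ∈ maxSubmodule hn hj hE := by rw [h]; trivial
  rw [maxSubmodule, Submodule.mem_comap, LinearEquiv.coe_coe, equivModel_vTop, GStable.mk_mem,
    mem_rsqMultiples] at h1
  have h2 : PolyOp.rsq ∣ (1 : MvPolynomial (Fin n) ℂ) := (dvd_pow_self _ (by omega)).trans h1
  obtain ⟨q, hq⟩ := h2
  have h3 := congrArg (MvPolynomial.eval 0) hq
  simp [PolyOp.rsq] at h3

/-- A proper submodule, moved to the model, cannot contain `1`, since `1` generates everything under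
multiplication by the coordinates. -/
lemma le_maxSubmodule (hn : 2 ≤ n) (hE₀ : 0 < E₀) {j : ℕ} (hj : 1 ≤ j)
    (hE : E₀ = (n : ℝ) / 2 - j) (S : Submodule (U n) (N n E₀)) (hS : S ≠ ⊤) :
    S ≤ maxSubmodule (by omega) hj hE := by
  set e := equivModel (n := n) (by omega) E₀ with he
  have h1 : (1 : MvPolynomial (Fin n) ℂ) ∉
      polys (S.comap (e.symm : Model n E₀ →ₗ[U n] N n E₀)) := by
    intro h
    apply hS
    have h2 := eq_top_of_one_mem h
    rw [eq_top_iff]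
    intro x _
    have h3 : e x ∈ S.comap (e.symm : Model n E₀ →ₗ[U n] N n E₀) := by rw [h2]; trivial
    rw [Submodule.mem_comap, LinearEquiv.coe_coe, e.symm_apply_apply] at h3
    exact h3
  have h2 := (gStable_polys _).le_rsqMultiples hn hE₀ hj hE h1
  intro x hx
  refine h2 (x := (Model.mk E₀).symm (e x)) ?_
  rw [mem_polys, Submodule.mem_comap, LinearEquiv.apply_symm_apply, LinearEquiv.coe_coe,
    e.symm_apply_apply]
  exact hx

lemma maxSubmodule_ne_bot (hn : 1 ≤ n) {j : ℕ} (hj : 1 ≤ j) (hE : E₀ = (n : ℝ) / 2 - j) :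
    maxSubmodule hn hj hE ≠ ⊥ := by
  intro h
  have h1 : (equivModel hn E₀).symm (Model.mk E₀ (PolyOp.rsq ^ j)) ∈ maxSubmodule hn hj hE := by
    rw [maxSubmodule, Submodule.mem_comap, LinearEquiv.coe_coe, LinearEquiv.apply_symm_apply,
      GStable.mk_mem, mem_rsqMultiples]
  rw [h, Submodule.mem_bot, LinearEquiv.map_eq_zero_iff, LinearEquiv.map_eq_zero_iff] at h1
  exact rsq_ne_zero hn (pow_eq_zero_iff (by omega) |>.1 h1)

lemma isSimpleModule_N (hn : 2 ≤ n) (hE₀ : 0 < E₀)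
    (hE : ∀ j : ℕ, 1 ≤ j → E₀ ≠ (n : ℝ) / 2 - j) : IsSimpleModule (U n) (N n E₀) := by
  have : IsSimpleModule (U n) (Model n E₀) := by
    have : Nontrivial (Model n E₀) :=
      inferInstanceAs (Nontrivial (MvPolynomial (Fin n) ℂ))
    refine { eq_bot_or_eq_top := fun T => ?_ }
    by_cases hT : T = ⊥
    · exact Or.inl hT
    · refine Or.inr (eq_top_of_one_mem ((gStable_polys T).one_mem hn hE₀ hE ?_))
      intro h
      apply hT
      rw [eq_bot_iff]
      intro p hp
      have h2 : (Model.mk E₀).symm p ∈ polys T := hp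
      rw [h, Submodule.mem_bot] at h2
      exact h2
  exact IsSimpleModule.congr (equivModel (by omega) E₀)

end SO2n

end

theorem mainTheorem5 (n : ℕ) (hn : 3 ≤ n) (E₀ : ℝ) (hE : 0 < E₀) :
    DirectSum.IsInternal (fun p : ℕ × ℕ => SO2n.Ukv n E₀ p.1 p.2) ∧
    (IsSimpleModule (SO2n.U n) (SO2n.N n E₀) ↔
      E₀ ∉ {x : ℝ | ∃ j : ℕ, 1 ≤ j ∧ j ≤ (n - 1) / 2 ∧ x = (n : ℝ) / 2 - j}) ∧
    ∀ j : ℕ, 1 ≤ j → j ≤ (n - 1) / 2 → E₀ = (n : ℝ) / 2 - j →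
      IsSimpleModule (SO2n.U n) (SO2n.L n E₀) ∧
      iSupIndep (fun p : ℕ × ℕ => SO2n.Ukv n E₀ p.1 (j + p.2)) ∧
      (∃ W : Submodule (SO2n.U n) (SO2n.N n E₀),
        W.restrictScalars (SO2n.Uk n) = ⨆ p : ℕ × ℕ, SO2n.Ukv n E₀ p.1 (j + p.2) ∧
        ∃ φ : SO2n.L n E₀ ≃ₗ[SO2n.U n] (SO2n.N n E₀ ⧸ W),
          ∀ x : SO2n.N n E₀, φ (Submodule.Quotient.mk x) = Submodule.Quotient.mk x) ∧
      ∃ ψ : (⨁ p : ℕ × Fin j, SO2n.Ukv n E₀ p.1 p.2) ≃ₗ[SO2n.Uk n] SO2n.L n E₀,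
        ∀ (p : ℕ × Fin j) (x : SO2n.Ukv n E₀ p.1 p.2),
          ψ (DirectSum.lof (SO2n.Uk n) (ℕ × Fin j) (fun p => SO2n.Ukv n E₀ p.1 p.2) p x) =
            Submodule.Quotient.mk (x : SO2n.N n E₀) := by
  have hind := SO2n.iSupIndep_Ukv hn E₀
  have htop := SO2n.iSup_Ukv hn E₀
  refine ⟨DirectSum.isInternal_submodule_of_iSupIndep_of_iSup_eq_top hind htop, ⟨?_, ?_⟩, ?_⟩
  · rintro hsimple ⟨j, hj, -, hEj⟩
    rcases hsimple.eq_bot_or_eq_top (SO2n.maxSubmodule (by omega) hj hEj) with h | h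
    · exact SO2n.maxSubmodule_ne_bot _ hj hEj h
    · exact SO2n.maxSubmodule_ne_top _ hj hEj h
  · intro hnot
    refine SO2n.isSimpleModule_N (by omega) hE fun j hj hEj => hnot ⟨j, hj, ?_, hEj⟩
    -- The upper bound on `j` is a consequence of `E₀ > 0`.
    have h : (2 * j : ℝ) < n := by linarith
    have h' : 2 * j < n := by exact_mod_cast h
    omega
  · intro j hj _ hEj
    have hle := SO2n.le_maxSubmodule (n := n) (by omega) hE hj hEj
    have hne := SO2n.maxSubmodule_ne_top (n := n) (by omega) hj hEj
    have hmax := maxProper_eq hne hle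
    have hres := SO2n.restrictScalars_maxSubmodule hn hj hEj
    refine ⟨?_, ?_, ⟨SO2n.maxSubmodule (by omega) hj hEj, hres,
      Submodule.quotEquivOfEq _ _ hmax, fun x => rfl⟩, ?_⟩
    · rw [isSimpleModule_iff_isCoatom, hmax]
      exact isCoatom_of_forall_le hne hle
    · refine hind.comp (f := fun p : ℕ × ℕ => (p.1, j + p.2)) ?_
      rintro ⟨a, b⟩ ⟨a', b'⟩ h
      simp only [Prod.mk.injEq] at h
      exact Prod.ext h.1 (by simpa using h.2)
    · refine exists_directSum_equiv_quotient (SO2n.Uk n) (SO2n.Ukv n E₀) hind htop j _ ?_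
      rw [hmax, hres]
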